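/- Notation. Let $N=2^n$, let $G_2=\begin{pmatrix}1&0\\1&1\end{pmatrix}$ over $\mathrm{GF}(2)$, let $A_n$ be the bit-reversal permutation matrix on $\{0,\dots,N-1\}$ and $H_n=A_nG_2^{\otimes n}$. For $0<D<\tfrac12$ let $W$ be the binary symmetric channel with crossover probability $D$. For $\bar y\in\{0,1\}^N$ and $0\le i<N$ put $$W^{(i)}(\bar y,u_0^{i-1}\mid u_i)=\frac1{2^{N-1}}\sum_{u_{i+1}^{N-1}}\prod_{j=0}^{N-1}W\bigl(y_j\mid(\bar uH_n)_j\bigr),\qquad l_i(\bar y,u_0^{i-1})=\frac{W^{(i)}(\bar y,u_0^{i-1}\mid 0)}{W^{(i)}(\bar y,u_0^{i-1}\mid 1)},$$ and let $Z^{(i)}=\sum_{\bar y,u_0^{i-1}}\sqrt{W^{(i)}(\bar y,u_0^{i-1}\mid0)\,W^{(i)}(\bar y,u_0^{i-1}\mid1)}$. A polar code of length $N$ (for design distortion $D$) is given by a frozen set of the form $F=\{i: Z^{(i)}\ge t\}$ for some real $t$; its codewords are the words $\bar uH_n$ with $u_i=0$ for $i\in F$, and its rate is $1-|F|/N$. Successive-cancellation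 (SC) encoding with randomized rounding maps a source word $\bar y$ to the random bits $\bar u_{F^c}$ obtained by determining $u_0,\dots,u_{N-1}$ in this order: $u_i=0$ if $i\in F$, and if $i\notin F$ then $u_i=0$ with probability $l_i/(1+l_i)$ and $u_i=1$ otherwise, where $l_i=l_i(\bar y,u_0^{i-1})$. The decoder maps $\bar u_{F^c}$ to $\bar x=\bar uH_n$ with $\bar u_F=0$. The expected distortion is the expectation of $\frac1N|\{j:x_j\ne y_j\}|$, where $\bar y$ is uniform on $\{0,1\}^N$ (a binary symmetric source), over the source and the randomness of the encoder. Let $h_2(D)=-D\log_2D-(1-D)\log_2(1-D)$. Theorem. Let $0<D<\tfrac12$, $R>1-h_2(D)$ and $0<\beta<\tfrac12$. There is a sequence of polar codes for design distortion $D$, one for each length $N=2^n$, $n\ge0$, with rates $R_N<R$, whose expected distortions $D_N$ under SC encoding with randomized rounding satisfy, for some constant $C$ and all $N$, $$D_N\le D+C\,2^{-N^\beta}.$$ Encoding and decoding of these codes have complexity $\Theta(N\log N)$: the recursive SC algorithm, which computes each likelihood ratio in the factor graph of $H_n$ once, produces exactly the random output of the SC encoder; the fast polar transform applied to the bits $\bar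 u$ produces exactly the output of the decoder; and the worst-case number of instructions executed by each of these two algorithms is $\Theta(N\log N)$ as $N=2^n\to\infty$, when one arithmetic operation on real numbers, one operation on bits, one selection of a real number by a bit, one loading of a constant and one drawing of a random bit of given bias count as one instruction each. -/

import Mathlib

namespace PolarSource

open scoped Kronecker

noncomputable section

/-! ## The polar transform

Bits are elements of `ZMod 2`, the block length is `N = 2 ^ n`, and words are row vectors
indexed by `Fin (2 ^ n)`. -/

/-- The kernel `G₂`. -/
def kernel : Matrix (Fin 2) (Fin 2) (ZMod 2) := !![1, 0; 1, 1]

/-- The Kronecker power `G₂^{⊗ n}`; the most significant bit of an index belongs to the leftmost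
factor. -/
def kernelPow : (n : ℕ) → Matrix (Fin (2 ^ n)) (Fin (2 ^ n)) (ZMod 2)
  | 0 => 1
  | n + 1 =>
    Matrix.reindex (finProdFinEquiv.trans (finCongr (pow_succ' 2 n).symm))
      (finProdFinEquiv.trans (finCongr (pow_succ' 2 n).symm)) (kernel ⊗ₖ kernelPow n)

/-- Reversal of the `n` binary digits of an index. -/
def bitRev : (n : ℕ) → Fin (2 ^ n) → Fin (2 ^ n)
  | 0, i => i
  | n + 1, i =>
    ⟨(i : ℕ) % 2 * 2 ^ n + bitRev n ⟨(i : ℕ) / 2, by have := i.isLt; omega⟩,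
      by
        have h1 := (bitRev n ⟨(i : ℕ) / 2, by have := i.isLt; omega⟩).isLt
        rcases Nat.mod_two_eq_zero_or_one (i : ℕ) with h | h <;> rw [h] <;> omega⟩

/-- The matrix `H_n = A_n G₂^{⊗ n}`, with `A_n` the bit-reversal permutation matrix. -/
def polarMatrix (n : ℕ) : Matrix (Fin (2 ^ n)) (Fin (2 ^ n)) (ZMod 2) :=
  (kernelPow n).submatrix (bitRev n) id

/-! ## The synthesized channels of the binary symmetric channel -/

/-- `bsc D y x` is the transition probability `W(y ∣ x)` of the binary symmetric channel with
crossover probability `D`. -/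
def bsc (D : ℝ) (y x : ZMod 2) : ℝ := if y = x then 1 - D else D

/-- `P(y ∣ u) = ∏ᵢ W(yᵢ ∣ (u H_n)ᵢ)`. -/
def blockLaw (D : ℝ) {n : ℕ} (y u : Fin (2 ^ n) → ZMod 2) : ℝ :=
  ∏ i, bsc D (y i) (Matrix.vecMul u (polarMatrix n) i)

/-- `synthChannel D i y p b` is `W^{(i)}(y, u₀^{i-1} ∣ uᵢ)` with `u₀^{i-1} = p` and `uᵢ = b`. -/
def synthChannel (D : ℝ) {n : ℕ} (i : Fin (2 ^ n)) (y : Fin (2 ^ n) → ZMod 2)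
    (p : Fin (i : ℕ) → ZMod 2) (b : ZMod 2) : ℝ :=
  1 / 2 ^ (2 ^ n - 1) *
    ∑ u : Fin (2 ^ n) → ZMod 2,
      if (∀ j : Fin (i : ℕ), u (Fin.castLE i.isLt.le j) = p j) ∧ u i = b
      then blockLaw D y u else 0

/-- The Bhattacharyya parameter `Z^{(i)}` of `W^{(i)}`. -/
def bhattacharyya (D : ℝ) {n : ℕ} (i : Fin (2 ^ n)) : ℝ :=
  ∑ y : Fin (2 ^ n) → ZMod 2, ∑ p : Fin (i : ℕ) → ZMod 2,
    √(synthChannel D i y p 0 * synthChannel D i y p 1)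

/-- The likelihood ratio `lᵢ(y, u₀^{i-1})`. -/
def likelihoodRatio (D : ℝ) {n : ℕ} (i : Fin (2 ^ n)) (y : Fin (2 ^ n) → ZMod 2)
    (p : Fin (i : ℕ) → ZMod 2) : ℝ :=
  synthChannel D i y p 0 / synthChannel D i y p 1

/-! ## Polar codes, successive-cancellation encoding and decoding -/

/-- A polar code of length `2 ^ n` for design distortion `D`: the frozen set consists of the indices
whose Bhattacharyya parameter (for the binary symmetric channel with crossover probability `D`)
reaches some threshold. -/
structure PolarCode (D : ℝ) (n : ℕ) where
  /-- the frozen set `F` -/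
  frozen : Finset (Fin (2 ^ n))
  /-- frozen indices are those with a large Bhattacharyya parameter -/
  threshold : ∃ t : ℝ, ∀ i, i ∈ frozen ↔ t ≤ bhattacharyya D i

/-- The rate `1 - |F| / N`. -/
def PolarCode.rate {D : ℝ} {n : ℕ} (c : PolarCode D n) : ℝ :=
  1 - (c.frozen.card : ℝ) / 2 ^ n

/-- A random bit which is `0` with probability `p` and `1` with probability `1 - p`
(where `p` is first clamped to `[0, 1]`). -/
def coin (p : ℝ) : PMF (ZMod 2) :=
  PMF.ofFintype
    (fun b => if b = 0 then ENNReal.ofReal (max 0 (min 1 p))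
      else ENNReal.ofReal (1 - max 0 (min 1 p)))
    (by
      have h0 : (0 : ℝ) ≤ max 0 (min 1 p) := le_max_left _ _
      have h1 : max 0 (min 1 p) ≤ (1 : ℝ) := max_le zero_le_one (min_le_left _ _)
      have hs : (Finset.univ : Finset (ZMod 2)) = {0, 1} := rfl
      rw [hs, Finset.sum_pair (by decide)]
      simp only [if_true, one_ne_zero, if_false]
      rw [← ENNReal.ofReal_add h0 (by linarith)]
      simp)

/-- The law of the first `k` bits `u₀, …, u_{k-1}` produced from the source word `y` by
successive cancellation with randomized rounding. Bits are determined in the order `0, …, N - 1`: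
a frozen bit is set to its frozen value, any other bit is set to `0` with probability
`lᵢ / (1 + lᵢ)` and to `1` otherwise. -/
def scPrefix (D : ℝ) {n : ℕ} (F : Finset (Fin (2 ^ n))) (w : Fin (2 ^ n) → ZMod 2)
    (y : Fin (2 ^ n) → ZMod 2) : (k : ℕ) → k ≤ 2 ^ n → PMF (Fin k → ZMod 2)
  | 0, _ => PMF.pure Fin.elim0
  | k + 1, hk =>
    (scPrefix D F w y k (Nat.le_of_succ_le hk)).bind fun p =>
      (if (⟨k, hk⟩ : Fin (2 ^ n)) ∈ F then PMF.pure (w ⟨k, hk⟩)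
        else coin (likelihoodRatio D ⟨k, hk⟩ y p / (1 + likelihoodRatio D ⟨k, hk⟩ y p))).map
      fun b => Fin.snoc p b

/-- The (random) encoding function: the law of the non-frozen bits `u_{F^c}` given the source
word `y`, when the frozen bits have the values `w` (only the coordinates of `w` in `F` matter). -/
def scEncoder (D : ℝ) {n : ℕ} (F : Finset (Fin (2 ^ n))) (w : Fin (2 ^ n) → ZMod 2)
    (y : Fin (2 ^ n) → ZMod 2) : PMF ({i // i ∉ F} → ZMod 2) :=
  (scPrefix D F w y (2 ^ n) le_rfl).map fun u i => u i

/-- Complete the non-frozen bits `v` by the frozen values `w`. -/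
def fillFrozen {n : ℕ} {α : Type} (F : Finset (Fin (2 ^ n))) (w : Fin (2 ^ n) → α)
    (v : {i // i ∉ F} → α) : Fin (2 ^ n) → α :=
  fun i => if h : i ∈ F then w i else v ⟨i, h⟩

/-- The decoding function: the reconstruction word `u H_n`. -/
def decoder {n : ℕ} (F : Finset (Fin (2 ^ n))) (w : Fin (2 ^ n) → ZMod 2)
    (v : {i // i ∉ F} → ZMod 2) : Fin (2 ^ n) → ZMod 2 :=
  Matrix.vecMul (fillFrozen F w v) (polarMatrix n)

/-- The expected Hamming distortion per source symbol: the source word is uniform on `{0,1}^N`,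
and the encoder is randomized. -/
def expectedDistortion (D : ℝ) {n : ℕ} (F : Finset (Fin (2 ^ n))) (w : Fin (2 ^ n) → ZMod 2) : ℝ :=
  ∑ y : Fin (2 ^ n) → ZMod 2, (1 / 2 ^ (2 ^ n)) *
    ∑ v : {i // i ∉ F} → ZMod 2, (scEncoder D F w y v).toReal *
      ((hammingDist y (decoder F w v) : ℝ) / 2 ^ n)

/-- The binary entropy function, in bits. -/
def h₂ (p : ℝ) : ℝ := Real.binEntropy p / Real.log 2

end

/-! ## Programs and their running time

A program works on wires of two abstract types: `V` (wires carrying real numbers) and `B` (wires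
carrying bits). It can touch the carried values only through the instructions below, each of which
takes one unit of time; routing of wires is free. The result of a program consists of wires. -/

/-- Programs with unit-cost instructions: real and bit constants, real arithmetic, addition of
bits, selection by a bit, and a random bit with a computed bias. Each instruction passes its result
to the rest of the program. -/
inductive Prog (V B : Type) (α : Type) : Type where
  /-- stop with the given result -/
  | ret (a : α)
  /-- load a real constant -/
  | real (c : ℝ) (k : V → Prog V B α)
  /-- load a bit constant -/
  | bit (b : ZMod 2) (k : B → Prog V B α)
  /-- add two reals -/
  | add (x y : V) (k : V → Prog V B α)
  /-- multiply two reals -/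
  | mul (x y : V) (k : V → Prog V B α)
  /-- divide two reals -/
  | div (x y : V) (k : V → Prog V B α)
  /-- add two bits modulo `2` -/
  | xor (a b : B) (k : B → Prog V B α)
  /-- the first real if the bit is `0`, the second one if the bit is `1` -/
  | sel (b : B) (x y : V) (k : V → Prog V B α)
  /-- a fresh random bit which is `0` with the given probability -/
  | flip (p : V) (k : B → Prog V B α)

namespace Prog

variable {V B α γ : Type}

/-- Sequential composition. -/
def bind : Prog V B α → (α → Prog V B γ) → Prog V B γ
  | ret a, f => f a
  | real c k, f => real c fun x => (k x).bind f
  | bit b k, f => bit b fun x => (k x).bind f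
  | add x y k, f => add x y fun z => (k z).bind f
  | mul x y k, f => mul x y fun z => (k z).bind f
  | div x y k, f => div x y fun z => (k z).bind f
  | xor a b k, f => xor a b fun z => (k z).bind f
  | sel b x y k, f => sel b x y fun z => (k z).bind f
  | flip p k, f => flip p fun z => (k z).bind f

instance : Monad (Prog V B) where
  pure := ret
  bind := bind

/-- Run `m` programs one after the other and collect their results. -/
def tabulate : {m : ℕ} → (Fin m → Prog V B α) → Prog V B (Fin m → α)
  | 0, _ => ret Fin.elim0
  | _ + 1, p => do
    let a ← p 0
    let as ← tabulate fun i => p i.succ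
    return Fin.cons a as

/-- The law of the result of a program, with wires interpreted as real numbers and bits. -/
noncomputable def run : Prog ℝ (ZMod 2) α → PMF α
  | ret a => PMF.pure a
  | real c k => (k c).run
  | bit b k => (k b).run
  | add x y k => (k (x + y)).run
  | mul x y k => (k (x * y)).run
  | div x y k => (k (x / y)).run
  | xor a b k => (k (a + b)).run
  | sel b x y k => (k (if b = 0 then x else y)).run
  | flip p k => (coin p).bind fun b => (k b).run

/-- The number of instructions executed by a program, in the worst case over its random bits. -/
noncomputable def time : Prog ℝ (ZMod 2) α → ℕ
  | ret _ => 0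
  | real c k => (k c).time + 1
  | bit b k => (k b).time + 1
  | add x y k => (k (x + y)).time + 1
  | mul x y k => (k (x * y)).time + 1
  | div x y k => (k (x / y)).time + 1
  | xor a b k => (k (a + b)).time + 1
  | sel b x y k => (k (if b = 0 then x else y)).time + 1
  | flip _ k => max (k 0).time (k 1).time + 1

end Prog

/-! ## The recursive successive-cancellation algorithm -/

section Algorithm

/-- The index `i` of the first half. -/
def lowerHalf {n : ℕ} (i : Fin (2 ^ n)) : Fin (2 ^ (n + 1)) :=
  ⟨i, by have := i.isLt; omega⟩

/-- The index `2 ^ n + i` of the second half. -/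
def upperHalf {n : ℕ} (i : Fin (2 ^ n)) : Fin (2 ^ (n + 1)) :=
  ⟨2 ^ n + i, by have := i.isLt; omega⟩

/-- The even index `2 i`. -/
def evenIdx {n : ℕ} (i : Fin (2 ^ n)) : Fin (2 ^ (n + 1)) :=
  ⟨2 * i, by have := i.isLt; omega⟩

/-- The odd index `2 i + 1`. -/
def oddIdx {n : ℕ} (i : Fin (2 ^ n)) : Fin (2 ^ (n + 1)) :=
  ⟨2 * i + 1, by have := i.isLt; omega⟩

/-- The word with first half `a` and second half `b`. -/
def concat {n : ℕ} {α : Type} (a b : Fin (2 ^ n) → α) : Fin (2 ^ (n + 1)) → α :=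
  fun i => if h : (i : ℕ) < 2 ^ n then a ⟨i, h⟩
    else b ⟨i - 2 ^ n, by have := i.isLt; omega⟩

/-- The word with the entries of `a` at the even and those of `b` at the odd positions. -/
def interleave {n : ℕ} {α : Type} (a b : Fin (2 ^ n) → α) : Fin (2 ^ (n + 1)) → α :=
  fun i =>
    if (i : ℕ) % 2 = 0
    then a ⟨i / 2, by have := i.isLt; omega⟩
    else b ⟨i / 2, by have := i.isLt; omega⟩

variable {V B : Type}

/-- The combination `(x y + 1) / (x + y)` of two likelihood ratios: the likelihood ratio of the sum
of two independently observed bits. -/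
def checkNode (x y : V) : Prog V B V :=
  .mul x y fun m => .real 1 fun e => .add m e fun s => .add x y fun t => .div s t .ret

/-- The combination `x ^ (1 - 2 a) y` of two likelihood ratios: the likelihood ratio of a bit `b`,
when the two observed bits are `a + b` and `b`. -/
def variableNode (a : B) (x y : V) : Prog V B V :=
  .real 1 fun e => .div e x fun r => .sel a x r fun z => .mul z y .ret

/-- The exclusive or of two bits. -/
def xorBits (a b : B) : Prog V B B := .xor a b .ret

/-- Successive cancellation with randomized rounding, from the likelihood ratios `l` of the code
bits; `fr i` is the value of bit `i` if it is frozen, and `none` otherwise. The result consists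
of the chosen bits `u` and of the corresponding code bits `u H_n`. -/
def scProg : (n : ℕ) → (Fin (2 ^ n) → Option (ZMod 2)) → (Fin (2 ^ n) → V) →
    Prog V B ((Fin (2 ^ n) → B) × (Fin (2 ^ n) → B))
  | 0, fr, l =>
    match fr 0 with
    | some b => .bit b fun u => .ret (fun _ => u, fun _ => u)
    | none => .real 1 fun e => .add e (l 0) fun s => .div (l 0) s fun p =>
        .flip p fun u => .ret (fun _ => u, fun _ => u)
  | n + 1, fr, l => do
    let l₁ ← Prog.tabulate fun i => checkNode (l (evenIdx i)) (l (oddIdx i))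
    let (u₁, a) ← scProg n (fun i => fr (lowerHalf i)) l₁
    let l₂ ← Prog.tabulate fun i => variableNode (a i) (l (evenIdx i)) (l (oddIdx i))
    let (u₂, b) ← scProg n (fun i => fr (upperHalf i)) l₂
    let c ← Prog.tabulate fun i => xorBits (a i) (b i)
    return (concat u₁ u₂, interleave c b)

/-- The encoding algorithm: it reads the source word `y`, converts it to likelihood ratios for the
binary symmetric channel with crossover probability `D`, runs successive cancellation and outputs
the non-frozen bits. -/
noncomputable def encoderProg (D : ℝ) {n : ℕ} (F : Finset (Fin (2 ^ n)))
    (w : Fin (2 ^ n) → ZMod 2) (y : Fin (2 ^ n) → B) : Prog V B ({i // i ∉ F} → B) := do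
  let l ← Prog.tabulate fun i =>
    .real ((1 - D) / D) fun l₀ => .real (D / (1 - D)) fun l₁ => .sel (y i) l₀ l₁ .ret
  let (u, _) ← scProg n (fun i => if i ∈ F then some (w i) else none) l
  return fun i => u i

/-- The fast polar transform of `u`. -/
def transformProg : (n : ℕ) → (Fin (2 ^ n) → B) → Prog V B (Fin (2 ^ n) → B)
  | 0, u => .ret u
  | n + 1, u => do
    let a ← transformProg n fun i => u (lowerHalf i)
    let b ← transformProg n fun i => u (upperHalf i)
    let c ← Prog.tabulate fun i => xorBits (a i) (b i)
    return interleave c b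

/-- The decoding algorithm: it inserts the frozen bits and applies the polar transform. -/
def decoderProg {n : ℕ} (F : Finset (Fin (2 ^ n))) (w : Fin (2 ^ n) → ZMod 2)
    (v : {i // i ∉ F} → B) : Prog V B (Fin (2 ^ n) → B) := do
  let f ← Prog.tabulate fun i => .bit (w i) .ret
  transformProg n (fillFrozen F f v)

/-- The worst-case running time of the encoding algorithm over all source words (and over the
randomness of the encoder). -/
noncomputable def encodingTime (D : ℝ) {n : ℕ} (F : Finset (Fin (2 ^ n)))
    (w : Fin (2 ^ n) → ZMod 2) : ℕ :=
  Finset.univ.sup fun y : Fin (2 ^ n) → ZMod 2 => (encoderProg D F w y).time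

/-- The worst-case running time of the decoding algorithm over all compressed words. -/
noncomputable def decodingTime {n : ℕ} (F : Finset (Fin (2 ^ n)))
    (w : Fin (2 ^ n) → ZMod 2) : ℕ :=
  Finset.univ.sup fun v : {i // i ∉ F} → ZMod 2 => (decoderProg F w v).time

end Algorithm

end PolarSource

namespace PolarSource

/-! ## Halves and parities of words -/

@[simp] theorem lowerHalf_val {n : ℕ} (i : Fin (2 ^ n)) : (lowerHalf i : ℕ) = i := rfl
@[simp] theorem upperHalf_val {n : ℕ} (i : Fin (2 ^ n)) : (upperHalf i : ℕ) = 2 ^ n + i := rfl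
@[simp] theorem evenIdx_val {n : ℕ} (i : Fin (2 ^ n)) : (evenIdx i : ℕ) = 2 * i := rfl
@[simp] theorem oddIdx_val {n : ℕ} (i : Fin (2 ^ n)) : (oddIdx i : ℕ) = 2 * i + 1 := rfl

@[simp] theorem concat_lowerHalf {n : ℕ} {α : Type} (a b : Fin (2 ^ n) → α) (i : Fin (2 ^ n)) :
    concat a b (lowerHalf i) = a i := by simp [concat]

@[simp] theorem concat_upperHalf {n : ℕ} {α : Type} (a b : Fin (2 ^ n) → α) (i : Fin (2 ^ n)) :
    concat a b (upperHalf i) = b i := by simp [concat]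

@[simp] theorem interleave_evenIdx {n : ℕ} {α : Type} (a b : Fin (2 ^ n) → α) (i : Fin (2 ^ n)) :
    interleave a b (evenIdx i) = a i := by simp [interleave]

@[simp] theorem interleave_oddIdx {n : ℕ} {α : Type} (a b : Fin (2 ^ n) → α) (i : Fin (2 ^ n)) :
    interleave a b (oddIdx i) = b i := by
  have h : (2 * (i : ℕ) + 1) / 2 = i := by omega
  simp [interleave, Nat.add_mod, h]

theorem half_cases {n : ℕ} (i : Fin (2 ^ (n + 1))) :
    (∃ j, i = lowerHalf j) ∨ ∃ j, i = upperHalf j := by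
  by_cases h : (i : ℕ) < 2 ^ n
  · exact .inl ⟨⟨i, h⟩, rfl⟩
  · refine .inr ⟨⟨i - 2 ^ n, by have := i.isLt; omega⟩, Fin.ext ?_⟩
    simp only [upperHalf_val]
    omega

theorem parity_cases {n : ℕ} (i : Fin (2 ^ (n + 1))) :
    (∃ j, i = evenIdx j) ∨ ∃ j, i = oddIdx j := by
  have hi := i.isLt
  rcases Nat.mod_two_eq_zero_or_one (i : ℕ) with h | h
  · refine .inl ⟨⟨i / 2, by omega⟩, Fin.ext ?_⟩
    simp only [evenIdx_val]
    omega
  · refine .inr ⟨⟨i / 2, by omega⟩, Fin.ext ?_⟩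
    simp only [oddIdx_val]
    omega

/-- Indices split into the lower and the upper half. -/
noncomputable def halfEquiv (n : ℕ) : Fin (2 ^ n) ⊕ Fin (2 ^ n) ≃ Fin (2 ^ (n + 1)) :=
  Equiv.ofBijective (Sum.elim lowerHalf upperHalf) (by
    constructor
    · rintro (a | a) (b | b) h <;> have ha := a.isLt <;> have hb := b.isLt <;>
        have h' := congrArg Fin.val h <;>
        simp only [Sum.elim_inl, Sum.elim_inr, lowerHalf_val, upperHalf_val] at h' <;>
        first
        | exact congrArg _ (Fin.ext (by omega))
        | omega
    · intro i
      rcases half_cases i with ⟨j, rfl⟩ | ⟨j, rfl⟩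
      · exact ⟨.inl j, rfl⟩
      · exact ⟨.inr j, rfl⟩)

/-- Indices split into the even and the odd ones. -/
noncomputable def parityEquiv (n : ℕ) : Fin (2 ^ n) ⊕ Fin (2 ^ n) ≃ Fin (2 ^ (n + 1)) :=
  Equiv.ofBijective (Sum.elim evenIdx oddIdx) (by
    constructor
    · rintro (a | a) (b | b) h <;> have h' := congrArg Fin.val h <;>
        simp only [Sum.elim_inl, Sum.elim_inr, evenIdx_val, oddIdx_val] at h' <;>
        first
        | exact congrArg _ (Fin.ext (by omega))
        | omega
    · intro i
      rcases parity_cases i with ⟨j, rfl⟩ | ⟨j, rfl⟩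
      · exact ⟨.inl j, rfl⟩
      · exact ⟨.inr j, rfl⟩)

theorem sum_halves {M : Type*} [AddCommMonoid M] {n : ℕ} (f : Fin (2 ^ (n + 1)) → M) :
    ∑ i, f i = ∑ i, f (lowerHalf i) + ∑ i, f (upperHalf i) := by
  rw [← (halfEquiv n).sum_comp, Fintype.sum_sum_type]
  rfl

theorem prod_parity {M : Type*} [CommMonoid M] {n : ℕ} (f : Fin (2 ^ (n + 1)) → M) :
    ∏ i, f i = ∏ i, (f (evenIdx i) * f (oddIdx i)) := by
  rw [← (parityEquiv n).prod_comp, Fintype.prod_sum_type, Finset.prod_mul_distrib]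
  rfl

/-- Words split into their two halves. -/
def concatEquiv (n : ℕ) (α : Type) :
    (Fin (2 ^ n) → α) × (Fin (2 ^ n) → α) ≃ (Fin (2 ^ (n + 1)) → α) where
  toFun p := concat p.1 p.2
  invFun u := (fun i => u (lowerHalf i), fun i => u (upperHalf i))
  left_inv p := by simp
  right_inv u := by
    funext i
    rcases half_cases i with ⟨j, rfl⟩ | ⟨j, rfl⟩ <;> simp

/-- Words split into their entries at even and at odd positions. -/
def interleaveEquiv (n : ℕ) (α : Type) :
    (Fin (2 ^ n) → α) × (Fin (2 ^ n) → α) ≃ (Fin (2 ^ (n + 1)) → α) where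
  toFun p := interleave p.1 p.2
  invFun u := (fun i => u (evenIdx i), fun i => u (oddIdx i))
  left_inv p := by simp
  right_inv u := by
    funext i
    rcases parity_cases i with ⟨j, rfl⟩ | ⟨j, rfl⟩ <;> simp

/-! ## The recursive structure of the polar transform -/

theorem polarMatrix_succ_apply (n : ℕ) (i j : Fin (2 ^ (n + 1))) :
    polarMatrix (n + 1) i j =
      kernel ⟨(i : ℕ) % 2, Nat.mod_lt _ two_pos⟩
          ⟨(j : ℕ) / 2 ^ n, Nat.div_lt_of_lt_mul (by have := j.isLt; omega)⟩ *
        polarMatrix n ⟨(i : ℕ) / 2, by have := i.isLt; omega⟩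
          ⟨(j : ℕ) % 2 ^ n, Nat.mod_lt _ (by positivity)⟩ := by
  have hb := (bitRev n ⟨(i : ℕ) / 2, by have := i.isLt; omega⟩).isLt
  simp only [polarMatrix, Matrix.submatrix_apply, id, kernelPow, Matrix.reindex_apply,
    Matrix.kroneckerMap_apply]
  congr 1
  · congr 1
    apply Fin.ext
    simp [bitRev, finProdFinEquiv, Fin.divNat, Nat.add_div_of_dvd_right, Nat.div_eq_of_lt hb]
  · congr 1
    apply Fin.ext
    simp [bitRev, finProdFinEquiv, Fin.modNat]
    exact Nat.mod_eq_of_lt hb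

theorem polarMatrix_succ_apply' (n : ℕ) (i j : Fin (2 ^ (n + 1))) :
    polarMatrix (n + 1) i j =
      kernel ⟨(i : ℕ) / 2 ^ n, Nat.div_lt_of_lt_mul (by have := i.isLt; omega)⟩
          ⟨(j : ℕ) % 2, Nat.mod_lt _ two_pos⟩ *
        polarMatrix n ⟨(i : ℕ) % 2 ^ n, Nat.mod_lt _ (by positivity)⟩
          ⟨(j : ℕ) / 2, by have := j.isLt; omega⟩ := by
  induction n with
  | zero =>
    rw [polarMatrix_succ_apply]
    have hi := i.isLt
    have hj := j.isLt
    congr 2 <;> apply Fin.ext <;> simp <;> omega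
  | succ n ih =>
    rw [polarMatrix_succ_apply, ih, polarMatrix_succ_apply n]
    rw [← mul_assoc, ← mul_assoc, mul_comm (kernel _ _) (kernel _ _)]
    have h1 : ∀ m : ℕ, m / 2 / 2 ^ n = m / 2 ^ (n + 1) := fun m => by
      rw [Nat.div_div_eq_div_mul, pow_succ']
    have h2 : ∀ m : ℕ, m % 2 ^ (n + 1) % 2 = m % 2 := fun m =>
      Nat.mod_mod_of_dvd _ (dvd_pow_self 2 n.succ_ne_zero)
    have h3 : ∀ m : ℕ, m % 2 ^ (n + 1) / 2 = m / 2 % 2 ^ n := fun m => by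
      rw [pow_succ', Nat.mod_mul_right_div_self]
    simp only [h1, h2, h3]

open Matrix

theorem kernel_zero_zero : kernel 0 0 = 1 := rfl
theorem kernel_zero_one : kernel 0 1 = 0 := rfl
theorem kernel_one_zero : kernel 1 0 = 1 := rfl
theorem kernel_one_one : kernel 1 1 = 1 := rfl

theorem polarMatrix_lowerHalf_evenIdx {n : ℕ} (i j : Fin (2 ^ n)) :
    polarMatrix (n + 1) (lowerHalf i) (evenIdx j) = polarMatrix n i j := by
  rw [polarMatrix_succ_apply']
  simp [Nat.mod_eq_of_lt, Nat.div_eq_of_lt, kernel_zero_zero]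

theorem polarMatrix_lowerHalf_oddIdx {n : ℕ} (i j : Fin (2 ^ n)) :
    polarMatrix (n + 1) (lowerHalf i) (oddIdx j) = 0 := by
  rw [polarMatrix_succ_apply']
  simp [Nat.div_eq_of_lt, Nat.add_mod, kernel_zero_one]

theorem polarMatrix_upperHalf_evenIdx {n : ℕ} (i j : Fin (2 ^ n)) :
    polarMatrix (n + 1) (upperHalf i) (evenIdx j) = polarMatrix n i j := by
  rw [polarMatrix_succ_apply']
  simp [Nat.mod_eq_of_lt, Nat.div_eq_of_lt, kernel_one_zero]

theorem polarMatrix_upperHalf_oddIdx {n : ℕ} (i j : Fin (2 ^ n)) :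
    polarMatrix (n + 1) (upperHalf i) (oddIdx j) = polarMatrix n i j := by
  rw [polarMatrix_succ_apply']
  have h : (2 * (j : ℕ) + 1) / 2 = j := by omega
  simp [Nat.mod_eq_of_lt, Nat.div_eq_of_lt, Nat.add_mod, kernel_one_one, h]

theorem vecMul_concat {n : ℕ} (a b : Fin (2 ^ n) → ZMod 2) :
    concat a b ᵥ* polarMatrix (n + 1) =
      interleave (a ᵥ* polarMatrix n + b ᵥ* polarMatrix n) (b ᵥ* polarMatrix n) := by
  funext j
  rcases parity_cases j with ⟨j, rfl⟩ | ⟨j, rfl⟩ <;>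
    simp [vecMul, dotProduct, sum_halves, polarMatrix_lowerHalf_evenIdx,
      polarMatrix_lowerHalf_oddIdx, polarMatrix_upperHalf_evenIdx, polarMatrix_upperHalf_oddIdx]

theorem vecMul_polarMatrix_zero (u : Fin (2 ^ 0) → ZMod 2) : u ᵥ* polarMatrix 0 = u := by
  have : polarMatrix 0 = 1 := by
    ext i j
    have hi : i = 0 := Subsingleton.elim (α := Fin 1) _ _
    have hj : j = 0 := Subsingleton.elim (α := Fin 1) _ _
    subst hi hj
    rfl
  rw [this, vecMul_one]

theorem vecMul_polarMatrix_injective (n : ℕ) :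
    Function.Injective fun u : Fin (2 ^ n) → ZMod 2 => u ᵥ* polarMatrix n := by
  induction n with
  | zero => intro u v h; simpa only [vecMul_polarMatrix_zero] using h
  | succ n ih =>
    intro u v h
    obtain ⟨⟨u₁, u₂⟩, rfl⟩ := (concatEquiv n _).surjective u
    obtain ⟨⟨v₁, v₂⟩, rfl⟩ := (concatEquiv n _).surjective v
    change concat u₁ u₂ ᵥ* _ = concat v₁ v₂ ᵥ* _ at h
    rw [vecMul_concat, vecMul_concat] at h
    have h' := (interleaveEquiv n (ZMod 2)).injective
      (a₁ := (u₁ ᵥ* polarMatrix n + u₂ ᵥ* polarMatrix n, u₂ ᵥ* polarMatrix n))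
      (a₂ := (v₁ ᵥ* polarMatrix n + v₂ ᵥ* polarMatrix n, v₂ ᵥ* polarMatrix n)) h
    rw [Prod.mk.injEq] at h'
    obtain ⟨h1, h2⟩ := h'
    rw [h2, add_left_inj] at h1
    rw [ih h1, ih h2]

/-- The polar transform, as a permutation of the set of words. -/
noncomputable def transformEquiv (n : ℕ) : (Fin (2 ^ n) → ZMod 2) ≃ (Fin (2 ^ n) → ZMod 2) :=
  Equiv.ofBijective (fun u => u ᵥ* polarMatrix n)
    (Finite.injective_iff_bijective.1 (vecMul_polarMatrix_injective n))

@[simp] theorem transformEquiv_apply (n : ℕ) (u : Fin (2 ^ n) → ZMod 2) :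
    transformEquiv n u = u ᵥ* polarMatrix n := rfl

/-! ## Weights of prefixes -/

/-- Given weights `f j x` for the code bit `x` at position `j`, the total weight of all
words `u` with prefix `p`. -/
noncomputable def prefixWeight {n : ℕ} (f : Fin (2 ^ n) → ZMod 2 → ℝ) (k : ℕ)
    (p : Fin k → ZMod 2) : ℝ :=
  ∑ u : Fin (2 ^ n) → ZMod 2,
    if ∀ (j : Fin k) (h : (j : ℕ) < 2 ^ n), u ⟨j, h⟩ = p j
    then ∏ i, f i ((u ᵥ* polarMatrix n) i) else 0

/-- Weights of the sum of two bits observed at neighbouring positions. -/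
def checkWeight {n : ℕ} (f : Fin (2 ^ (n + 1)) → ZMod 2 → ℝ) (j : Fin (2 ^ n)) (a : ZMod 2) : ℝ :=
  ∑ b : ZMod 2, f (evenIdx j) (a + b) * f (oddIdx j) b

/-- Weights of a bit observed at an odd position and, after addition of the known bit `a j`, at the
preceding even position. -/
def variableWeight {n : ℕ} (f : Fin (2 ^ (n + 1)) → ZMod 2 → ℝ) (a : Fin (2 ^ n) → ZMod 2)
    (j : Fin (2 ^ n)) (b : ZMod 2) : ℝ :=
  f (evenIdx j) (a j + b) * f (oddIdx j) b

theorem prod_concat {n : ℕ} (f : Fin (2 ^ (n + 1)) → ZMod 2 → ℝ) (u₁ u₂ : Fin (2 ^ n) → ZMod 2) :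
    ∏ i, f i ((concat u₁ u₂ ᵥ* polarMatrix (n + 1)) i) =
      ∏ j, variableWeight f (u₁ ᵥ* polarMatrix n) j ((u₂ ᵥ* polarMatrix n) j) := by
  rw [prod_parity, vecMul_concat]
  simp [variableWeight]

theorem sum_prod_eq {ι : Type*} [Fintype ι] [DecidableEq ι] (f : ι → ZMod 2 → ℝ) :
    ∑ x : ι → ZMod 2, ∏ i, f i (x i) = ∏ i, ∑ b, f i b := by
  rw [Finset.prod_univ_sum, Fintype.piFinset_univ]

theorem sum_transform {n : ℕ} (f : Fin (2 ^ n) → ZMod 2 → ℝ) :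
    ∑ u : Fin (2 ^ n) → ZMod 2, ∏ i, f i ((u ᵥ* polarMatrix n) i) = ∏ i, ∑ b, f i b := by
  rw [← sum_prod_eq]
  exact (transformEquiv n).sum_comp fun x => ∏ i, f i (x i)

theorem prefixWeight_checkWeight {n : ℕ} (f : Fin (2 ^ (n + 1)) → ZMod 2 → ℝ) {k : ℕ}
    (hk : k ≤ 2 ^ n) (p : Fin k → ZMod 2) :
    prefixWeight f k p = prefixWeight (checkWeight f) k p := by
  unfold prefixWeight
  rw [← (concatEquiv n _).sum_comp, Fintype.sum_prod_type]
  refine Finset.sum_congr rfl fun u₁ _ => ?_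
  have hc : ∀ u₂ : Fin (2 ^ n) → ZMod 2,
      (∀ (j : Fin k) (h : (j : ℕ) < 2 ^ (n + 1)), concatEquiv n _ (u₁, u₂) ⟨j, h⟩ = p j) ↔
      ∀ (j : Fin k) (h : (j : ℕ) < 2 ^ n), u₁ ⟨j, h⟩ = p j := by
    intro u₂
    refine forall_congr' fun j => ⟨fun h h' => ?_, fun h h' => ?_⟩
    · exact (concat_lowerHalf u₁ u₂ ⟨j, h'⟩).symm.trans (h _)
    · exact (concat_lowerHalf u₁ u₂ ⟨j, j.isLt.trans_le hk⟩).trans (h _)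
  simp only [hc]
  split_ifs
  · simp only [concatEquiv, Equiv.coe_fn_mk, prod_concat]
    rw [sum_transform]
    rfl
  · simp

theorem prefixWeight_variableWeight {n : ℕ} (f : Fin (2 ^ (n + 1)) → ZMod 2 → ℝ) (k : ℕ)
    (p : Fin (2 ^ n) → ZMod 2) (q : Fin k → ZMod 2) :
    prefixWeight f (2 ^ n + k) (Fin.append p q) =
      prefixWeight (variableWeight f (p ᵥ* polarMatrix n)) k q := by
  unfold prefixWeight
  rw [← (concatEquiv n _).sum_comp, Fintype.sum_prod_type, Finset.sum_eq_single p]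
  · refine Finset.sum_congr rfl fun u₂ _ => ?_
    refine if_congr ?_ (prod_concat _ _ _) rfl
    constructor
    · intro h j hj
      have := h (Fin.natAdd _ j) (by simp; omega)
      rw [Fin.append_right] at this
      exact (concat_upperHalf p u₂ ⟨j, hj⟩).symm.trans this
    · intro h j
      refine Fin.addCases (fun j => ?_) (fun j => ?_) j
      · intro _
        rw [Fin.append_left]
        exact concat_lowerHalf p u₂ j
      · intro hj
        rw [Fin.append_right]
        have hj' : (j : ℕ) < 2 ^ n := by simp at hj; omega
        exact (concat_upperHalf p u₂ ⟨j, hj'⟩).trans (h j hj')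
  · intro u₁ _ hu
    refine Finset.sum_eq_zero fun u₂ _ => if_neg fun h => hu ?_
    funext j
    have := h (Fin.castAdd _ j) (by have := j.isLt; simp; omega)
    rw [Fin.append_left] at this
    exact (concat_lowerHalf u₁ u₂ j).symm.trans this
  · simp

theorem prefixWeight_snoc_add {n : ℕ} (f : Fin (2 ^ n) → ZMod 2 → ℝ) {k : ℕ} (hk : k < 2 ^ n)
    (p : Fin k → ZMod 2) :
    ∑ b : ZMod 2, prefixWeight f (k + 1) (Fin.snoc p b) = prefixWeight f k p := by
  unfold prefixWeight
  rw [Finset.sum_comm]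
  refine Finset.sum_congr rfl fun u _ => ?_
  have hc : ∀ b : ZMod 2, (∀ (j : Fin (k + 1)) (h : (j : ℕ) < 2 ^ n),
      u ⟨j, h⟩ = (Fin.snoc p b : Fin (k + 1) → ZMod 2) j) ↔
      b = u ⟨k, hk⟩ ∧ ∀ (j : Fin k) (h : (j : ℕ) < 2 ^ n), u ⟨j, h⟩ = p j := by
    intro b
    rw [Fin.forall_fin_succ']
    simp only [Fin.val_castSucc, Fin.snoc_castSucc, Fin.val_last, Fin.snoc_last]
    constructor
    · exact fun h => ⟨(h.2 hk).symm, h.1⟩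
    · exact fun h => ⟨h.2, fun _ => h.1.symm⟩
  simp only [hc, ite_and, Finset.sum_ite_eq', Finset.mem_univ, if_true]

theorem prefixWeight_pos {n : ℕ} {f : Fin (2 ^ n) → ZMod 2 → ℝ} (hf : ∀ i b, 0 < f i b) (k : ℕ)
    (p : Fin k → ZMod 2) : 0 < prefixWeight f k p := by
  refine Finset.sum_pos' (fun u _ => ?_)
    ⟨fun i => if h : (i : ℕ) < k then p ⟨i, h⟩ else 0, Finset.mem_univ _, ?_⟩
  · split_ifs
    · exact Finset.prod_nonneg fun i _ => (hf _ _).le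
    · exact le_rfl
  · rw [if_pos (by intro j h; simp)]
    exact Finset.prod_pos fun i _ => hf _ _

theorem prefixWeight_zero {n : ℕ} (f : Fin (2 ^ n) → ZMod 2 → ℝ) (p : Fin 0 → ZMod 2) :
    prefixWeight f 0 p = ∏ i, ∑ b, f i b := by
  rw [← sum_transform]
  exact Finset.sum_congr rfl fun u _ => if_pos fun j => j.elim0

theorem prefixWeight_full {n : ℕ} (f : Fin (2 ^ n) → ZMod 2 → ℝ) (u : Fin (2 ^ n) → ZMod 2) :
    prefixWeight f (2 ^ n) u = ∏ i, f i ((u ᵥ* polarMatrix n) i) := by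
  unfold prefixWeight
  rw [Finset.sum_eq_single u]
  · exact if_pos fun _ _ => rfl
  · exact fun v _ hv => if_neg fun h => hv (funext fun j => h j j.isLt)
  · simp

theorem prefixWeight_const_mul {n : ℕ} (f : Fin (2 ^ n) → ZMod 2 → ℝ) (c : ℝ) (k : ℕ)
    (p : Fin k → ZMod 2) :
    prefixWeight (fun i b => c * f i b) k p = c ^ 2 ^ n * prefixWeight f k p := by
  unfold prefixWeight
  rw [Finset.mul_sum]
  refine Finset.sum_congr rfl fun u _ => ?_
  rw [mul_ite, mul_zero, Finset.prod_mul_distrib]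
  simp

theorem synthChannel_eq (D : ℝ) {n : ℕ} (i : Fin (2 ^ n)) (y : Fin (2 ^ n) → ZMod 2)
    (p : Fin (i : ℕ) → ZMod 2) (b : ZMod 2) :
    synthChannel D i y p b =
      1 / 2 ^ (2 ^ n - 1) * prefixWeight (fun j => bsc D (y j)) (i + 1) (Fin.snoc p b) := by
  unfold synthChannel prefixWeight
  congr 1
  refine Finset.sum_congr rfl fun u _ => if_congr ?_ rfl rfl
  rw [Fin.forall_fin_succ']
  simp only [Fin.val_castSucc, Fin.snoc_castSucc, Fin.val_last, Fin.snoc_last, Fin.eta]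
  constructor
  · exact fun h => ⟨fun j _ => h.1 j, fun _ => h.2⟩
  · exact fun h => ⟨fun j => h.1 j (j.isLt.trans i.isLt), h.2 i.isLt⟩

end PolarSource

namespace PolarSource
open Matrix

/-! ## Running programs -/

namespace Prog

variable {α γ : Type}

@[simp] theorem run_ret (a : α) : (ret a : Prog ℝ (ZMod 2) α).run = PMF.pure a := rfl

@[simp] theorem run_pure (a : α) : (pure a : Prog ℝ (ZMod 2) α).run = PMF.pure a := rfl

@[simp] theorem run_bind (p : Prog ℝ (ZMod 2) α) (f : α → Prog ℝ (ZMod 2) γ) :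
    (p >>= f).run = p.run.bind fun a => (f a).run := by
  change (p.bind f).run = _
  induction p with
  | ret a => simp [Prog.bind]
  | flip p k ih => simp only [Prog.bind, run, ih, PMF.bind_bind]
  | _ => simp_all [Prog.bind, run]

theorem run_tabulate {m : ℕ} {p : Fin m → Prog ℝ (ZMod 2) α} {a : Fin m → α}
    (h : ∀ i, (p i).run = PMF.pure (a i)) : (tabulate p).run = PMF.pure a := by
  induction m with
  | zero => exact congrArg PMF.pure (Subsingleton.elim _ _)
  | succ m ih =>
    simp only [tabulate, run_bind, h, PMF.pure_bind, ih fun i => h i.succ, run_pure]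
    congr 1
    funext i
    refine Fin.cases ?_ (fun i => ?_) i <;> simp

end Prog

theorem run_checkNode (x y : ℝ) :
    (checkNode x y : Prog ℝ (ZMod 2) ℝ).run = PMF.pure ((x * y + 1) / (x + y)) := rfl

theorem run_variableNode (a : ZMod 2) (x y : ℝ) :
    (variableNode a x y).run = PMF.pure ((if a = 0 then x else 1 / x) * y) := rfl

theorem run_xorBits (a b : ZMod 2) : (xorBits a b : Prog ℝ (ZMod 2) _).run = PMF.pure (a + b) := rfl

theorem run_transformProg : ∀ (n : ℕ) (u : Fin (2 ^ n) → ZMod 2),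
    (transformProg n u : Prog ℝ (ZMod 2) _).run = PMF.pure (u ᵥ* polarMatrix n)
  | 0, u => by rw [vecMul_polarMatrix_zero]; rfl
  | n + 1, u => by
    obtain ⟨⟨u₁, u₂⟩, rfl⟩ := (concatEquiv n _).surjective u
    change (transformProg (n + 1) (concat u₁ u₂)).run = PMF.pure (concat u₁ u₂ ᵥ* _)
    simp only [transformProg, concat_lowerHalf, concat_upperHalf, Prog.run_bind,
      run_transformProg n, PMF.pure_bind, Prog.run_tabulate fun i => run_xorBits _ _,
      Prog.run_pure, vecMul_concat]
    rfl

theorem run_decoderProg {n : ℕ} (F : Finset (Fin (2 ^ n))) (w : Fin (2 ^ n) → ZMod 2)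
    (v : {i // i ∉ F} → ZMod 2) :
    (decoderProg F w v : Prog ℝ (ZMod 2) _).run = PMF.pure (decoder F w v) := by
  simp only [decoderProg, Prog.run_bind,
    Prog.run_tabulate (p := fun i => Prog.bit (w i) Prog.ret) (a := w) fun i => rfl,
    PMF.pure_bind, run_transformProg, decoder]

/-! ## Sequential samplers -/

/-- The law of `k` bits that are drawn one after the other, bit `i` according to `κ i` applied to
the previous bits. -/
noncomputable def seqLaw (κ : (k : ℕ) → (Fin k → ZMod 2) → PMF (ZMod 2)) :
    (k : ℕ) → PMF (Fin k → ZMod 2)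
  | 0 => PMF.pure Fin.elim0
  | k + 1 => (seqLaw κ k).bind fun p => (κ k p).map fun b => Fin.snoc p b

theorem seqLaw_congr {κ κ' : (k : ℕ) → (Fin k → ZMod 2) → PMF (ZMod 2)} {m : ℕ}
    (h : ∀ k < m, ∀ p, κ k p = κ' k p) : seqLaw κ m = seqLaw κ' m := by
  induction m with
  | zero => rfl
  | succ m ih =>
    simp only [seqLaw, ih fun k hk => h k (hk.trans m.lt_succ_self), h m m.lt_succ_self]

theorem seqLaw_add (κ : (k : ℕ) → (Fin k → ZMod 2) → PMF (ZMod 2)) (a b : ℕ) :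
    seqLaw κ (a + b) = (seqLaw κ a).bind fun p =>
      (seqLaw (fun k q => κ (a + k) (Fin.append p q)) b).map (Fin.append p) := by
  induction b with
  | zero =>
    have h : ∀ p : Fin a → ZMod 2, Fin.append p Fin.elim0 = p := fun p => by
      rw [Fin.append_elim0]; rfl
    simp only [seqLaw, PMF.pure_map, h, PMF.bind_pure]
    rfl
  | succ b ih =>
    change (seqLaw κ (a + b)).bind _ = _
    simp only [seqLaw, ih, PMF.bind_bind, PMF.map_bind, PMF.bind_map, Function.comp_def,
      PMF.map_comp, Fin.append_snoc]
    rfl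

theorem seqLaw_two_pow_succ (κ : (k : ℕ) → (Fin k → ZMod 2) → PMF (ZMod 2)) (n : ℕ) :
    seqLaw κ (2 ^ (n + 1)) = (seqLaw κ (2 ^ n)).bind fun p =>
      (seqLaw (fun k q => κ (2 ^ n + k) (Fin.append p q)) (2 ^ n)).map (concat p) := by
  have key : ∀ (m : ℕ) (h : m = 2 ^ n + 2 ^ n), seqLaw κ m = (seqLaw κ (2 ^ n)).bind fun p =>
      (seqLaw (fun k q => κ (2 ^ n + k) (Fin.append p q)) (2 ^ n)).map
        fun q i => Fin.append p q (Fin.cast h i) := by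
    rintro _ rfl
    exact seqLaw_add κ _ _
  have h2 : 2 ^ (n + 1) = 2 ^ n + 2 ^ n := by ring
  rw [key _ h2]
  congr 1
  funext p
  congr 1
  funext q i
  rcases half_cases i with ⟨j, rfl⟩ | ⟨j, rfl⟩
  · rw [concat_lowerHalf]
    exact Fin.append_left p q j
  · rw [concat_upperHalf]
    exact Fin.append_right p q j

/-- The ratio of the weights of the two continuations of the prefix `p`. -/
noncomputable def weightRatio {n : ℕ} (f : Fin (2 ^ n) → ZMod 2 → ℝ) (k : ℕ)
    (p : Fin k → ZMod 2) : ℝ :=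
  prefixWeight f (k + 1) (Fin.snoc p 0) / prefixWeight f (k + 1) (Fin.snoc p 1)

/-- One step of successive cancellation with randomized rounding. -/
noncomputable def scStep {n : ℕ} (fr : Fin (2 ^ n) → Option (ZMod 2))
    (f : Fin (2 ^ n) → ZMod 2 → ℝ) (k : ℕ) (p : Fin k → ZMod 2) : PMF (ZMod 2) :=
  if h : k < 2 ^ n then
    match fr ⟨k, h⟩ with
    | some b => PMF.pure b
    | none => coin (weightRatio f k p / (1 + weightRatio f k p))
  else PMF.pure 0

theorem likelihoodRatio_eq (D : ℝ) {n : ℕ} (i : Fin (2 ^ n)) (y : Fin (2 ^ n) → ZMod 2)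
    (p : Fin (i : ℕ) → ZMod 2) :
    likelihoodRatio D i y p = weightRatio (fun j => bsc D (y j)) i p := by
  unfold likelihoodRatio weightRatio
  rw [synthChannel_eq, synthChannel_eq, mul_div_mul_left _ _ (by positivity)]

/-- The description of the frozen bits that is used by the encoding algorithm. -/
def frozenBits {n : ℕ} (F : Finset (Fin (2 ^ n))) (w : Fin (2 ^ n) → ZMod 2) (i : Fin (2 ^ n)) :
    Option (ZMod 2) :=
  if i ∈ F then some (w i) else none

theorem scPrefix_eq (D : ℝ) {n : ℕ} (F : Finset (Fin (2 ^ n))) (w y : Fin (2 ^ n) → ZMod 2) :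
    ∀ (k : ℕ) (hk : k ≤ 2 ^ n),
      scPrefix D F w y k hk = seqLaw (scStep (frozenBits F w) fun j => bsc D (y j)) k
  | 0, _ => rfl
  | k + 1, hk => by
    rw [scPrefix, seqLaw, scPrefix_eq D F w y k]
    congr 1
    funext p
    rw [scStep, dif_pos (Nat.lt_of_succ_le hk)]
    by_cases h : (⟨k, hk⟩ : Fin (2 ^ n)) ∈ F
    · simp only [frozenBits, if_pos h]
    · simp only [frozenBits, if_neg h, likelihoodRatio_eq]

theorem weightRatio_checkWeight {n : ℕ} (f : Fin (2 ^ (n + 1)) → ZMod 2 → ℝ) {k : ℕ}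
    (hk : k < 2 ^ n) (p : Fin k → ZMod 2) :
    weightRatio f k p = weightRatio (checkWeight f) k p := by
  unfold weightRatio
  rw [prefixWeight_checkWeight f hk, prefixWeight_checkWeight f hk]

theorem weightRatio_variableWeight {n : ℕ} (f : Fin (2 ^ (n + 1)) → ZMod 2 → ℝ) (k : ℕ)
    (p : Fin (2 ^ n) → ZMod 2) (q : Fin k → ZMod 2) :
    weightRatio f (2 ^ n + k) (Fin.append p q) =
      weightRatio (variableWeight f (p ᵥ* polarMatrix n)) k q := by
  unfold weightRatio
  rw [← Fin.append_snoc, ← Fin.append_snoc]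
  change prefixWeight f (2 ^ n + (k + 1)) _ / prefixWeight f (2 ^ n + (k + 1)) _ = _
  rw [prefixWeight_variableWeight, prefixWeight_variableWeight]

theorem scStep_lowerHalf {n : ℕ} (fr : Fin (2 ^ (n + 1)) → Option (ZMod 2))
    (f : Fin (2 ^ (n + 1)) → ZMod 2 → ℝ) {k : ℕ} (hk : k < 2 ^ n) (p : Fin k → ZMod 2) :
    scStep fr f k p = scStep (fun i => fr (lowerHalf i)) (checkWeight f) k p := by
  have h : k < 2 ^ (n + 1) := by rw [pow_succ]; omega
  rw [scStep, scStep, dif_pos h, dif_pos hk, weightRatio_checkWeight f hk]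
  rfl

theorem scStep_upperHalf {n : ℕ} (fr : Fin (2 ^ (n + 1)) → Option (ZMod 2))
    (f : Fin (2 ^ (n + 1)) → ZMod 2 → ℝ) {k : ℕ} (hk : k < 2 ^ n) (p : Fin (2 ^ n) → ZMod 2)
    (q : Fin k → ZMod 2) :
    scStep fr f (2 ^ n + k) (Fin.append p q) =
      scStep (fun i => fr (upperHalf i)) (variableWeight f (p ᵥ* polarMatrix n)) k q := by
  have h : 2 ^ n + k < 2 ^ (n + 1) := by rw [pow_succ]; omega
  rw [scStep, scStep, dif_pos h, dif_pos hk, weightRatio_variableWeight f]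
  rfl

theorem sum_bits {M : Type*} [AddCommMonoid M] (f : ZMod 2 → M) : ∑ b, f b = f 0 + f 1 :=
  Fin.sum_univ_two f

theorem bit_cases (b : ZMod 2) : b = 0 ∨ b = 1 := by
  revert b; decide

theorem bit_add_self (b : ZMod 2) : b + b = 0 := by
  revert b; decide

theorem checkWeight_pos {n : ℕ} {f : Fin (2 ^ (n + 1)) → ZMod 2 → ℝ} (hf : ∀ i b, 0 < f i b)
    (i : Fin (2 ^ n)) (b : ZMod 2) : 0 < checkWeight f i b :=
  Finset.sum_pos (fun _ _ => mul_pos (hf _ _) (hf _ _)) Finset.univ_nonempty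

theorem variableWeight_pos {n : ℕ} {f : Fin (2 ^ (n + 1)) → ZMod 2 → ℝ} (hf : ∀ i b, 0 < f i b)
    (a : Fin (2 ^ n) → ZMod 2) (i : Fin (2 ^ n)) (b : ZMod 2) : 0 < variableWeight f a i b :=
  mul_pos (hf _ _) (hf _ _)

/-- The recursive successive-cancellation algorithm computes the law of the bits that are chosen
by successive cancellation, together with the corresponding code bits. -/
theorem run_scProg : ∀ (n : ℕ) (fr : Fin (2 ^ n) → Option (ZMod 2)) (l : Fin (2 ^ n) → ℝ)
    (f : Fin (2 ^ n) → ZMod 2 → ℝ), (∀ i b, 0 < f i b) → (∀ i, l i = f i 0 / f i 1) →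
    (scProg n fr l).run = (seqLaw (scStep fr f) (2 ^ n)).map fun u => (u, u ᵥ* polarMatrix n)
  | 0, fr, l, f, hf, hl => by
    have hconst : ∀ (u : Fin (2 ^ 0) → ZMod 2) (b : ZMod 2), u 0 = b → u = fun _ => b := by
      intro u b h
      funext i
      rw [Subsingleton.elim (α := Fin 1) i 0, h]
    have hs : ∀ b : ZMod 2, (Fin.snoc (Fin.elim0 : Fin 0 → ZMod 2) b : Fin (2 ^ 0) → ZMod 2)
        = fun _ => b := fun b => hconst _ _ rfl
    have hratio : weightRatio f 0 Fin.elim0 = l 0 := by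
      have hw : ∀ b : ZMod 2, prefixWeight f (0 + 1) (Fin.snoc Fin.elim0 b) = f 0 b := by
        intro b
        refine (prefixWeight_full f _).trans ?_
        rw [vecMul_polarMatrix_zero, hs]
        exact Fin.prod_univ_one fun i => f i b
      rw [weightRatio, hw, hw, hl]
    have hlaw : seqLaw (scStep fr f) (2 ^ 0) =
        (scStep fr f 0 Fin.elim0).map fun b => (fun _ => b : Fin (2 ^ 0) → ZMod 2) := by
      change (seqLaw _ 0).bind _ = _
      rw [seqLaw, PMF.pure_bind]
      exact congrArg (fun g => PMF.map g _) (funext hs)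
    rw [hlaw, PMF.map_comp, scStep, dif_pos (by norm_num), hratio]
    simp only [Function.comp_def, vecMul_polarMatrix_zero, scProg]
    change _ = PMF.map _ (match fr 0 with | some b => _ | none => _)
    rcases fr 0 with _ | b
    · rfl
    · simp only [PMF.pure_map]; rfl
  | n + 1, fr, l, f, hf, hl => by
    have hl₁ : ∀ i, (l (evenIdx i) * l (oddIdx i) + 1) / (l (evenIdx i) + l (oddIdx i)) =
        checkWeight f i 0 / checkWeight f i 1 := by
      intro i
      have := hf (evenIdx i) 0
      have := hf (evenIdx i) 1
      have := hf (oddIdx i) 0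
      have := hf (oddIdx i) 1
      simp only [hl, checkWeight, sum_bits, add_zero, zero_add, bit_add_self]
      field_simp
      ring
    have hl₂ : ∀ (a : Fin (2 ^ n) → ZMod 2) (i), (if a i = 0 then l (evenIdx i)
        else 1 / l (evenIdx i)) * l (oddIdx i) = variableWeight f a i 0 / variableWeight f a i 1 := by
      intro a i
      have := hf (evenIdx i) 0
      have := hf (evenIdx i) 1
      have := hf (oddIdx i) 0
      have := hf (oddIdx i) 1
      rcases bit_cases (a i) with h | h <;>
        simp only [hl, h, variableWeight, add_zero, zero_add, bit_add_self, if_true,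
          one_ne_zero, if_false] <;> field_simp
    rw [seqLaw_two_pow_succ, seqLaw_congr fun k hk p => scStep_lowerHalf fr f hk p]
    simp only [scProg, Prog.run_bind, Prog.run_tabulate fun i => run_checkNode _ _, PMF.pure_bind,
      run_scProg n _ _ _ (checkWeight_pos hf) hl₁, PMF.bind_map, PMF.map_bind, PMF.map_comp,
      Function.comp_def, Prog.run_tabulate fun i => run_variableNode _ _ _]
    congr 1
    funext p
    rw [seqLaw_congr fun k hk q => scStep_upperHalf fr f hk p q,
      run_scProg n _ _ _ (variableWeight_pos hf _) (hl₂ _)]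
    simp only [Prog.run_tabulate fun i => run_xorBits _ _, PMF.pure_bind, PMF.bind_map,
      Function.comp_def, Prog.run_pure, vecMul_concat]
    rfl

theorem bsc_pos {D : ℝ} (hD0 : 0 < D) (hD1 : D < 1) (y x : ZMod 2) : 0 < bsc D y x := by
  unfold bsc
  split_ifs
  · linarith
  · exact hD0

theorem run_encoderProg {D : ℝ} (hD0 : 0 < D) (hD1 : D < 1) {n : ℕ} (F : Finset (Fin (2 ^ n)))
    (w y : Fin (2 ^ n) → ZMod 2) : (encoderProg D F w y).run = scEncoder D F w y := by
  have hl : ∀ i, (if y i = 0 then (1 - D) / D else D / (1 - D)) =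
      bsc D (y i) 0 / bsc D (y i) 1 := by
    intro i
    rcases bit_cases (y i) with h | h <;> simp [h, bsc]
  have ht : ∀ i, (Prog.real ((1 - D) / D) fun l₀ => .real (D / (1 - D)) fun l₁ =>
      .sel (y i) l₀ l₁ .ret : Prog ℝ (ZMod 2) ℝ).run =
        PMF.pure (if y i = 0 then (1 - D) / D else D / (1 - D)) := fun i => rfl
  simp only [encoderProg, Prog.run_bind, Prog.run_tabulate ht, PMF.pure_bind, scEncoder,
    run_scProg n _ _ (fun j => bsc D (y j)) (fun i b => bsc_pos hD0 hD1 _ _) hl, PMF.bind_map,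
    Function.comp_def, Prog.run_pure, scPrefix_eq]
  rfl

end PolarSource

namespace PolarSource
open Matrix

/-! ## Running times -/

namespace Prog

variable {α γ : Type}

theorem time_bind {p : Prog ℝ (ZMod 2) α} {f : α → Prog ℝ (ZMod 2) γ} {t : ℕ}
    (h : ∀ a, (f a).time = t) : (p >>= f).time = p.time + t := by
  change (p.bind f).time = _
  induction p with
  | ret a => simp [Prog.bind, time, h]
  | flip p k ih => simp only [Prog.bind, time, ih]; omega
  | _ => simp_all [Prog.bind, time]; try omega

theorem time_tabulate {m : ℕ} {p : Fin m → Prog ℝ (ZMod 2) α} {t : ℕ}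
    (h : ∀ i, (p i).time = t) : (tabulate p).time = m * t := by
  induction m with
  | zero => simp [tabulate, time]
  | succ m ih =>
    rw [tabulate, time_bind (t := m * t), h, add_mul, one_mul, add_comm]
    intro a
    rw [time_bind (t := 0), ih fun i => h i.succ, add_zero]
    exact fun _ => rfl

end Prog

theorem time_transformProg : ∀ (n : ℕ) (u : Fin (2 ^ n) → ZMod 2),
    2 * (transformProg n u : Prog ℝ (ZMod 2) _).time = n * 2 ^ n
  | 0, u => by simp [transformProg, Prog.time]
  | n + 1, u => by
    have h := time_transformProg n
    have h' : ∀ u v, (transformProg n u : Prog ℝ (ZMod 2) _).time =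
        (transformProg n v : Prog ℝ (ZMod 2) _).time := fun u v => by
      have := h u; have := h v; omega
    have ht : ∀ a b : Fin (2 ^ n) → ZMod 2, (Prog.tabulate fun i => xorBits (a i) (b i) :
        Prog ℝ (ZMod 2) _).time = 2 ^ n * 1 := fun a b => Prog.time_tabulate fun i => rfl
    rw [transformProg, Prog.time_bind (t := (transformProg n (0 : Fin (2 ^ n) → ZMod 2) : Prog ℝ (ZMod 2) _).time + 2 ^ n)]
    · have := h fun i => u (lowerHalf i)
      have := h 0
      rw [pow_succ]
      nlinarith
    · intro a
      rw [Prog.time_bind (t := 2 ^ n), h' _ 0]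
      intro b
      rw [Prog.time_bind (t := 0), ht, mul_one, add_zero]
      exact fun _ => rfl

/-- The cost of deciding a single bit. -/
def bitCost : Option (ZMod 2) → ℕ
  | some _ => 1
  | none => 4

theorem time_scProg : ∀ (n : ℕ) (fr : Fin (2 ^ n) → Option (ZMod 2)) (l : Fin (2 ^ n) → ℝ),
    (scProg n fr l).time = 5 * n * 2 ^ n + ∑ i, bitCost (fr i)
  | 0, fr, l => by
    have : ∑ i : Fin (2 ^ 0), bitCost (fr i) = bitCost (fr 0) := Fin.sum_univ_one _
    rw [this, scProg]
    rcases fr 0 with _ | b <;> simp [Prog.time, bitCost]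
  | n + 1, fr, l => by
    have h := time_scProg n
    have hc : ∀ l : Fin (2 ^ (n + 1)) → ℝ, (Prog.tabulate fun i =>
        checkNode (l (evenIdx i)) (l (oddIdx i)) : Prog ℝ (ZMod 2) _).time = 2 ^ n * 5 :=
      fun l => Prog.time_tabulate fun i => rfl
    have hv : ∀ (a : Fin (2 ^ n) → ZMod 2) (l : Fin (2 ^ (n + 1)) → ℝ), (Prog.tabulate fun i =>
        variableNode (a i) (l (evenIdx i)) (l (oddIdx i))).time = 2 ^ n * 4 :=
      fun a l => Prog.time_tabulate fun i => rfl
    have ht : ∀ a b : Fin (2 ^ n) → ZMod 2, (Prog.tabulate fun i => xorBits (a i) (b i) :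
        Prog ℝ (ZMod 2) _).time = 2 ^ n * 1 := fun a b => Prog.time_tabulate fun i => rfl
    set s₁ := 5 * n * 2 ^ n + ∑ i, bitCost (fr (lowerHalf i)) with hs₁
    set s₂ := 5 * n * 2 ^ n + ∑ i, bitCost (fr (upperHalf i)) with hs₂
    rw [scProg, Prog.time_bind (t := s₁ + (2 ^ n * 4 + (s₂ + 2 ^ n))), hc, sum_halves]
    · rw [hs₁, hs₂, pow_succ]; ring
    · intro l₁
      rw [Prog.time_bind (t := 2 ^ n * 4 + (s₂ + 2 ^ n)), h]
      rintro ⟨u₁, a⟩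
      dsimp only
      rw [Prog.time_bind (t := s₂ + 2 ^ n), hv]
      intro l₂
      rw [Prog.time_bind (t := 2 ^ n), h]
      rintro ⟨u₂, b⟩
      dsimp only
      rw [Prog.time_bind (t := 0), ht, mul_one, add_zero]
      exact fun _ => rfl

theorem time_encoderProg (D : ℝ) {n : ℕ} (F : Finset (Fin (2 ^ n))) (w y : Fin (2 ^ n) → ZMod 2) :
    (encoderProg D F w y).time =
      3 * 2 ^ n + (5 * n * 2 ^ n + ∑ i, bitCost (if i ∈ F then some (w i) else none)) := by
  rw [encoderProg, Prog.time_bind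
    (t := 5 * n * 2 ^ n + ∑ i, bitCost (if i ∈ F then some (w i) else none)),
    Prog.time_tabulate (t := 3), mul_comm]
  · exact fun i => rfl
  · intro l
    rw [Prog.time_bind (t := 0), time_scProg, add_zero]
    exact fun _ => rfl

theorem encodingTime_bounds (D : ℝ) {n : ℕ} (F : Finset (Fin (2 ^ n)))
    (w : Fin (2 ^ n) → ZMod 2) :
    n * 2 ^ n ≤ encodingTime D F w ∧ encodingTime D F w ≤ (7 + 5 * n) * 2 ^ n := by
  have hs : ∑ i, bitCost (if i ∈ F then some (w i) else none) ≤ 2 ^ n * 4 := by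
    refine (Finset.sum_le_card_nsmul _ _ 4 fun i _ => ?_).trans_eq (by simp)
    split_ifs <;> simp [bitCost]
  simp only [encodingTime, time_encoderProg]
  rw [Finset.sup_const Finset.univ_nonempty]
  have h1 : 5 * n * 2 ^ n = 5 * (n * 2 ^ n) := by ring
  have h2 : (7 + 5 * n) * 2 ^ n = 7 * 2 ^ n + 5 * (n * 2 ^ n) := by ring
  omega

theorem decodingTime_eq {n : ℕ} (F : Finset (Fin (2 ^ n))) (w : Fin (2 ^ n) → ZMod 2) :
    2 * decodingTime F w = (2 + n) * 2 ^ n := by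
  have h : ∀ v : {i // i ∉ F} → ZMod 2, (decoderProg F w v : Prog ℝ (ZMod 2) _).time =
      2 ^ n * 1 + (transformProg n (0 : Fin (2 ^ n) → ZMod 2) : Prog ℝ (ZMod 2) _).time := by
    intro v
    rw [decoderProg, Prog.time_bind
      (t := (transformProg n (0 : Fin (2 ^ n) → ZMod 2) : Prog ℝ (ZMod 2) _).time),
      Prog.time_tabulate (t := 1) fun _ => rfl]
    intro f
    have h1 := time_transformProg n (fillFrozen F f v)
    have h2 := time_transformProg n 0
    omega
  simp only [decodingTime, h]
  rw [Finset.sup_const Finset.univ_nonempty, mul_add, time_transformProg]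
  ring

open Asymptotics Filter in
theorem isTheta_of_bounds {T : ℕ → ℕ} {a b : ℝ} (ha : 0 < a)
    (hl : ∀ n : ℕ, a * (n * 2 ^ n) ≤ (T n : ℝ))
    (hu : ∀ n : ℕ, 1 ≤ n → (T n : ℝ) ≤ b * (n * 2 ^ n)) :
    (fun n => (T n : ℝ)) =Θ[atTop] fun n => (2 : ℝ) ^ n * Real.log ((2 : ℝ) ^ n) := by
  have hlog : 0 < Real.log 2 := Real.log_pos one_lt_two
  have hN : ∀ n : ℕ, (2 : ℝ) ^ n * Real.log ((2 : ℝ) ^ n) = Real.log 2 * (n * 2 ^ n) := fun n => by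
    rw [Real.log_pow]; ring
  have hpos : ∀ n : ℕ, (0 : ℝ) ≤ n * 2 ^ n := fun n => by positivity
  constructor
  · refine IsBigO.of_bound (b / Real.log 2) ?_
    filter_upwards [eventually_ge_atTop 1] with n hn
    rw [hN, Real.norm_of_nonneg (by positivity), Real.norm_of_nonneg
      (mul_nonneg hlog.le (hpos n)), ← mul_assoc, div_mul_cancel₀ _ hlog.ne']
    exact hu n hn
  · refine IsBigO.of_bound (Real.log 2 / a) (Eventually.of_forall fun n => ?_)
    rw [hN, Real.norm_of_nonneg (mul_nonneg hlog.le (hpos n)),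
      Real.norm_of_nonneg (Nat.cast_nonneg _), div_mul_eq_mul_div, le_div_iff₀ ha]
    have := mul_le_mul_of_nonneg_left (hl n) hlog.le
    linarith

open Asymptotics Filter in
theorem encodingTime_isTheta (D : ℝ) (F : (n : ℕ) → Finset (Fin (2 ^ n))) :
    (fun n => (encodingTime D (F n) 0 : ℝ))
      =Θ[atTop] fun n => (2 : ℝ) ^ n * Real.log ((2 : ℝ) ^ n) := by
  refine isTheta_of_bounds (a := 1) (b := 12) one_pos (fun n => ?_) fun n hn => ?_
  · have := (encodingTime_bounds D (F n) 0).1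
    rw [one_mul]
    exact_mod_cast this
  · have h := (encodingTime_bounds D (F n) 0).2
    have : (7 + 5 * n) * 2 ^ n ≤ 12 * (n * 2 ^ n) := by
      rw [← mul_assoc]
      exact Nat.mul_le_mul_right _ (by omega)
    exact_mod_cast h.trans this

open Asymptotics Filter in
theorem decodingTime_isTheta (F : (n : ℕ) → Finset (Fin (2 ^ n))) :
    (fun n => (decodingTime (F n) 0 : ℝ))
      =Θ[atTop] fun n => (2 : ℝ) ^ n * Real.log ((2 : ℝ) ^ n) := by
  have h : ∀ n, (2 : ℝ) * decodingTime (F n) 0 = (2 + n) * 2 ^ n := fun n => by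
    exact_mod_cast decodingTime_eq (F n) 0
  refine isTheta_of_bounds (a := 1 / 2) (b := 2) (by norm_num) (fun n => ?_) fun n hn => ?_
  · nlinarith [h n, pow_pos (two_pos : (0 : ℝ) < 2) n]
  · have hn' : (1 : ℝ) ≤ n := by exact_mod_cast hn
    nlinarith [h n, pow_pos (two_pos : (0 : ℝ) < 2) n]

end PolarSource

namespace PolarSource

/-! ## Bits with side information -/

/-- A random bit together with finitely valued side information, given by positive joint
probabilities. -/
structure BitSource where
  /-- the values of the side information -/
  Y : Type
  /-- there are finitely many values -/
  fin : Fintype Y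
  /-- the joint probabilities of side information and bit -/
  J : Y → ZMod 2 → ℝ
  /-- probabilities are positive -/
  pos : ∀ y b, 0 < J y b
  /-- probabilities sum to one -/
  sum_eq : ∑ y, (J y 0 + J y 1) = 1

namespace BitSource

attribute [instance] fin

/-- Sum a function of the two joint probabilities over all values of the side information. -/
noncomputable def functional (Φ : ℝ → ℝ → ℝ) (c : BitSource) : ℝ := ∑ y, Φ (c.J y 0) (c.J y 1)

/-- The sum of two independent copies of the bit, with the side information on both. -/
noncomputable def minus (c : BitSource) : BitSource where
  Y := c.Y × c.Y
  fin := inferInstance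
  J y a := ∑ b, c.J y.1 (a + b) * c.J y.2 b
  pos _ _ := Finset.sum_pos (fun _ _ => mul_pos (c.pos _ _) (c.pos _ _)) Finset.univ_nonempty
  sum_eq := by
    have h := congrArg₂ (· * ·) c.sum_eq c.sum_eq
    simp only [Finset.sum_mul_sum, mul_one] at h
    rw [Fintype.sum_prod_type, ← h]
    refine Finset.sum_congr rfl fun y₁ _ => Finset.sum_congr rfl fun y₂ _ => ?_
    simp only [sum_bits, add_zero, zero_add, bit_add_self]
    ring

/-- The second of two independent copies of the bit, with the side information on both and the sum
of the two bits as side information. -/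
noncomputable def plus (c : BitSource) : BitSource where
  Y := (c.Y × c.Y) × ZMod 2
  fin := inferInstance
  J y b := c.J y.1.1 (y.2 + b) * c.J y.1.2 b
  pos _ _ := mul_pos (c.pos _ _) (c.pos _ _)
  sum_eq := by
    have h := congrArg₂ (· * ·) c.sum_eq c.sum_eq
    simp only [Finset.sum_mul_sum, mul_one] at h
    rw [Fintype.sum_prod_type, Fintype.sum_prod_type, ← h]
    refine Finset.sum_congr rfl fun y₁ _ => Finset.sum_congr rfl fun y₂ _ => ?_
    simp only [sum_bits, add_zero, zero_add, bit_add_self]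
    ring

theorem sum_sum_mul (c : BitSource) (A : c.Y → ℝ) :
    ∑ y₁, ∑ y₂, (A y₁ * (c.J y₂ 0 + c.J y₂ 1) + (c.J y₁ 0 + c.J y₁ 1) * A y₂) = 2 * ∑ y, A y := by
  have h : ∀ y₁, ∑ y₂, (A y₁ * (c.J y₂ 0 + c.J y₂ 1) + (c.J y₁ 0 + c.J y₁ 1) * A y₂) =
      A y₁ + (c.J y₁ 0 + c.J y₁ 1) * ∑ y, A y := fun y₁ => by
    rw [Finset.sum_add_distrib, ← Finset.mul_sum, ← Finset.mul_sum, c.sum_eq, mul_one]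
  rw [Finset.sum_congr rfl fun y₁ _ => h y₁, Finset.sum_add_distrib, ← Finset.sum_mul, c.sum_eq]
  ring

theorem functional_minus (Φ : ℝ → ℝ → ℝ) (c : BitSource) :
    c.minus.functional Φ = ∑ y₁, ∑ y₂, Φ (c.J y₁ 0 * c.J y₂ 0 + c.J y₁ 1 * c.J y₂ 1)
      (c.J y₁ 1 * c.J y₂ 0 + c.J y₁ 0 * c.J y₂ 1) := by
  refine (Fintype.sum_prod_type _).trans ?_
  simp only [minus, sum_bits, add_zero, zero_add, bit_add_self]

theorem functional_plus (Φ : ℝ → ℝ → ℝ) (c : BitSource) :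
    c.plus.functional Φ = ∑ y₁, ∑ y₂, (Φ (c.J y₁ 0 * c.J y₂ 0) (c.J y₁ 1 * c.J y₂ 1) +
      Φ (c.J y₁ 1 * c.J y₂ 0) (c.J y₁ 0 * c.J y₂ 1)) := by
  refine (Fintype.sum_prod_type _).trans ((Fintype.sum_prod_type _).trans ?_)
  simp only [plus, sum_bits, add_zero, zero_add, bit_add_self]

/-- The expected bias of the bit given the side information. -/
noncomputable def bias (c : BitSource) : ℝ := c.functional fun a b => |a - b|

/-- The Bhattacharyya parameter. -/
noncomputable def bhat (c : BitSource) : ℝ := c.functional fun a b => 2 * √(a * b)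

/-- The expected squared bias of the bit given the side information. -/
noncomputable def sqBias (c : BitSource) : ℝ := c.functional fun a b => (a - b) ^ 2 / (a + b)

/-- The contribution of one value of the side information to the conditional entropy. -/
noncomputable def entTerm (a b : ℝ) : ℝ :=
  Real.negMulLog a + Real.negMulLog b - Real.negMulLog (a + b)

/-- The conditional entropy (in nats) of the bit given the side information. -/
noncomputable def entropy (c : BitSource) : ℝ := c.functional entTerm

theorem bias_nonneg (c : BitSource) : 0 ≤ c.bias := Finset.sum_nonneg fun _ _ => abs_nonneg _

theorem bias_minus (c : BitSource) : c.minus.bias = c.bias ^ 2 := by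
  rw [bias, functional_minus, sq, bias, functional, Finset.sum_mul_sum]
  refine Finset.sum_congr rfl fun y₁ _ => Finset.sum_congr rfl fun y₂ _ => ?_
  rw [← abs_mul]
  congr 1
  ring

theorem bias_plus_le (c : BitSource) : c.plus.bias ≤ 2 * c.bias := by
  have h : ∀ y₁ y₂, |c.J y₁ 0 * c.J y₂ 0 - c.J y₁ 1 * c.J y₂ 1| +
      |c.J y₁ 1 * c.J y₂ 0 - c.J y₁ 0 * c.J y₂ 1| ≤
      |c.J y₁ 0 - c.J y₁ 1| * (c.J y₂ 0 + c.J y₂ 1) +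
        (c.J y₁ 0 + c.J y₁ 1) * |c.J y₂ 0 - c.J y₂ 1| := by
    intro y₁ y₂
    have a1 := c.pos y₁ 0
    have b1 := c.pos y₁ 1
    have a2 := c.pos y₂ 0
    have b2 := c.pos y₂ 1
    generalize c.J y₁ 0 = a₁ at *
    generalize c.J y₁ 1 = b₁ at *
    generalize c.J y₂ 0 = a₂ at *
    generalize c.J y₂ 1 = b₂ at *
    have e1 : |a₁ * a₂ - b₁ * b₂| ≤ (|a₁ - b₁| * (a₂ + b₂) + (a₁ + b₁) * |a₂ - b₂|) / 2 := by
      have : a₁ * a₂ - b₁ * b₂ = ((a₁ - b₁) * (a₂ + b₂) + (a₁ + b₁) * (a₂ - b₂)) / 2 := by ring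
      rw [this, abs_div, abs_two]
      refine div_le_div_of_nonneg_right ((abs_add_le _ _).trans_eq ?_) two_pos.le
      rw [abs_mul, abs_mul, abs_of_pos (add_pos a2 b2), abs_of_pos (add_pos a1 b1)]
    have e2 : |b₁ * a₂ - a₁ * b₂| ≤ (|a₁ - b₁| * (a₂ + b₂) + (a₁ + b₁) * |a₂ - b₂|) / 2 := by
      have : b₁ * a₂ - a₁ * b₂ = (-(a₁ - b₁) * (a₂ + b₂) + (a₁ + b₁) * (a₂ - b₂)) / 2 := by ring
      rw [this, abs_div, abs_two]
      refine div_le_div_of_nonneg_right ((abs_add_le _ _).trans_eq ?_) two_pos.le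
      rw [abs_mul, abs_mul, abs_neg, abs_of_pos (add_pos a2 b2), abs_of_pos (add_pos a1 b1)]
    linarith
  calc c.plus.bias ≤ ∑ y₁, ∑ y₂, (|c.J y₁ 0 - c.J y₁ 1| * (c.J y₂ 0 + c.J y₂ 1) +
        (c.J y₁ 0 + c.J y₁ 1) * |c.J y₂ 0 - c.J y₂ 1|) := by
        rw [bias, functional_plus]
        exact Finset.sum_le_sum fun y₁ _ => Finset.sum_le_sum fun y₂ _ => h y₁ y₂
    _ = 2 * c.bias := by
        exact c.sum_sum_mul fun y => |c.J y 0 - c.J y 1|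

theorem one_sub_bias_le_bhat (c : BitSource) : 1 - c.bias ≤ c.bhat := by
  rw [← c.sum_eq, bias, bhat, functional, functional, ← Finset.sum_sub_distrib]
  refine Finset.sum_le_sum fun y _ => ?_
  have ha := (c.pos y 0).le
  have hb := (c.pos y 1).le
  rcases le_total (c.J y 0) (c.J y 1) with h | h
  · rw [abs_of_nonpos (by linarith)]
    have : c.J y 0 ≤ √(c.J y 0 * c.J y 1) := Real.le_sqrt_of_sq_le (by nlinarith)
    linarith
  · rw [abs_of_nonneg (by linarith)]
    have : c.J y 1 ≤ √(c.J y 0 * c.J y 1) := Real.le_sqrt_of_sq_le (by nlinarith)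
    linarith

theorem bias_sq_le (c : BitSource) : c.bias ^ 2 ≤ 2 * (1 - c.bhat) := by
  have h0 : ∀ y, c.J y 0 = √(c.J y 0) ^ 2 := fun y => (Real.sq_sqrt (c.pos y 0).le).symm
  have h1 : ∀ y, c.J y 1 = √(c.J y 1) ^ 2 := fun y => (Real.sq_sqrt (c.pos y 1).le).symm
  have hm : ∀ y, √(c.J y 0 * c.J y 1) = √(c.J y 0) * √(c.J y 1) :=
    fun y => Real.sqrt_mul (c.pos y 0).le _
  have e1 : ∑ y, (√(c.J y 0) - √(c.J y 1)) ^ 2 = 1 - c.bhat := by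
    rw [← c.sum_eq, bhat, functional, ← Finset.sum_sub_distrib]
    refine Finset.sum_congr rfl fun y _ => ?_
    rw [hm]
    linarith [h0 y, h1 y, sq_nonneg (√(c.J y 0))]
  have e2 : ∑ y, (√(c.J y 0) + √(c.J y 1)) ^ 2 = 1 + c.bhat := by
    rw [← c.sum_eq, bhat, functional, ← Finset.sum_add_distrib]
    refine Finset.sum_congr rfl fun y _ => ?_
    rw [hm]
    linarith [h0 y, h1 y, sq_nonneg (√(c.J y 0))]
  have e3 : c.bias = ∑ y, |√(c.J y 0) - √(c.J y 1)| * (√(c.J y 0) + √(c.J y 1)) := by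
    refine Finset.sum_congr rfl fun y _ => ?_
    change |c.J y 0 - c.J y 1| = _
    conv_lhs => rw [h0 y, h1 y]
    have : 0 ≤ √(c.J y 0) + √(c.J y 1) := by positivity
    rw [sq_sub_sq, abs_mul, abs_of_nonneg this, mul_comm]
  have h := Finset.sum_mul_sq_le_sq_mul_sq Finset.univ
    (fun y => |√(c.J y 0) - √(c.J y 1)|) (fun y => √(c.J y 0) + √(c.J y 1))
  simp only [sq_abs] at h
  rw [← e3, e1, e2] at h
  have hz : 0 ≤ 1 - c.bhat := e1 ▸ Finset.sum_nonneg fun _ _ => sq_nonneg _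
  nlinarith

theorem bias_sq_le_sqBias (c : BitSource) : c.bias ^ 2 ≤ c.sqBias := by
  have h := Finset.sum_mul_sq_le_sq_mul_sq Finset.univ
    (fun y => |c.J y 0 - c.J y 1| / √(c.J y 0 + c.J y 1)) (fun y => √(c.J y 0 + c.J y 1))
  have hs : ∀ y, 0 < c.J y 0 + c.J y 1 := fun y => add_pos (c.pos y 0) (c.pos y 1)
  simp only [div_pow, sq_abs, Real.sq_sqrt (hs _).le, div_mul_cancel₀ _ (Real.sqrt_pos.2 (hs _)).ne',
    c.sum_eq, mul_one] at h
  exact h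

theorem bhat_sq_le (c : BitSource) : c.bhat ^ 2 ≤ 1 - c.sqBias := by
  have hs : ∀ y, 0 < c.J y 0 + c.J y 1 := fun y => add_pos (c.pos y 0) (c.pos y 1)
  have h := Finset.sum_mul_sq_le_sq_mul_sq Finset.univ
    (fun y => 2 * √(c.J y 0 * c.J y 1) / √(c.J y 0 + c.J y 1)) (fun y => √(c.J y 0 + c.J y 1))
  simp only [div_pow, mul_pow, Real.sq_sqrt (hs _).le,
    Real.sq_sqrt (mul_pos (c.pos _ 0) (c.pos _ 1)).le, div_mul_cancel₀ _ (Real.sqrt_pos.2 (hs _)).ne', c.sum_eq, mul_one] at h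
  refine h.trans_eq ?_
  rw [← c.sum_eq, sqBias, functional, ← Finset.sum_sub_distrib]
  refine Finset.sum_congr rfl fun y _ => ?_
  have := (hs y).ne'
  field_simp
  ring

/-! ### Entropy -/

theorem entropy_minus_add_plus (c : BitSource) :
    c.minus.entropy + c.plus.entropy = 2 * c.entropy := by
  have h : ∀ y₁ y₂, entTerm (c.J y₁ 0 * c.J y₂ 0 + c.J y₁ 1 * c.J y₂ 1)
      (c.J y₁ 1 * c.J y₂ 0 + c.J y₁ 0 * c.J y₂ 1) + (entTerm (c.J y₁ 0 * c.J y₂ 0)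
      (c.J y₁ 1 * c.J y₂ 1) + entTerm (c.J y₁ 1 * c.J y₂ 0) (c.J y₁ 0 * c.J y₂ 1)) =
      entTerm (c.J y₁ 0) (c.J y₁ 1) * (c.J y₂ 0 + c.J y₂ 1) +
        (c.J y₁ 0 + c.J y₁ 1) * entTerm (c.J y₂ 0) (c.J y₂ 1) := by
    intro y₁ y₂
    have : c.J y₁ 0 * c.J y₂ 0 + c.J y₁ 1 * c.J y₂ 1 + (c.J y₁ 1 * c.J y₂ 0 + c.J y₁ 0 * c.J y₂ 1)
      = (c.J y₁ 0 + c.J y₁ 1) * (c.J y₂ 0 + c.J y₂ 1) := by ring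
    simp only [entTerm, this, Real.negMulLog_mul]
    ring
  rw [entropy, entropy, functional_minus, functional_plus, ← Finset.sum_add_distrib]
  simp only [← Finset.sum_add_distrib (f := fun _ => entTerm _ _), h]
  exact c.sum_sum_mul fun y => entTerm (c.J y 0) (c.J y 1)

theorem entTerm_eq {a b : ℝ} (ha : 0 < a) (hb : 0 < b) :
    entTerm a b = (a + b) * Real.binEntropy ((1 + (a - b) / (a + b)) / 2) := by
  have hs : a + b ≠ 0 := (add_pos ha hb).ne'
  have e1 : (1 + (a - b) / (a + b)) / 2 = a / (a + b) := by field_simp; ring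
  have e2 : 1 - a / (a + b) = b / (a + b) := by field_simp; ring
  rw [e1, Real.binEntropy_eq_negMulLog_add_negMulLog_one_sub, e2, entTerm]
  simp only [Real.negMulLog, Real.log_div ha.ne' hs, Real.log_div hb.ne' hs]
  field_simp
  ring

theorem entropy_le_log_two (c : BitSource) : c.entropy ≤ Real.log 2 := by
  rw [← one_mul (Real.log 2), ← c.sum_eq, Finset.sum_mul, entropy]
  refine Finset.sum_le_sum fun y _ => ?_
  rw [entTerm_eq (c.pos y 0) (c.pos y 1)]
  exact mul_le_mul_of_nonneg_left Real.binEntropy_le_log_two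
    (add_pos (c.pos y 0) (c.pos y 1)).le

theorem entTerm_nonneg {a b : ℝ} (ha : 0 < a) (hb : 0 < b) : 0 ≤ entTerm a b := by
  have e1 : (1 + (a - b) / (a + b)) / 2 = a / (a + b) := by field_simp; ring
  rw [entTerm_eq ha hb, e1]
  exact mul_nonneg (by positivity) (Real.binEntropy_nonneg (by positivity)
    (div_le_one_of_le₀ (by linarith) (by positivity)))

theorem entropy_nonneg (c : BitSource) : 0 ≤ c.entropy :=
  Finset.sum_nonneg fun y _ => entTerm_nonneg (c.pos y 0) (c.pos y 1)

theorem entTerm_le {a b : ℝ} (ha : 0 < a) (hb : 0 < b) : entTerm a b ≤ 2 * √(a * b) := by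
  have hs : 0 < a + b := add_pos ha hb
  have key : ∀ x : ℝ, 0 < x → x * (Real.log (a + b) - Real.log x) ≤
      2 * (√(a + b) * √x - x) := by
    intro x hx
    have h1 : Real.log (√(a + b) / √x) ≤ √(a + b) / √x - 1 := Real.log_le_sub_one_of_pos
      (div_pos (Real.sqrt_pos.2 hs) (Real.sqrt_pos.2 hx))
    rw [Real.log_div (Real.sqrt_pos.2 hs).ne' (Real.sqrt_pos.2 hx).ne', Real.log_sqrt hs.le,
      Real.log_sqrt hx.le] at h1
    have h2 : x * (√(a + b) / √x) = √(a + b) * √x := by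
      have := (Real.sqrt_pos.2 hx).ne'
      field_simp
      rw [Real.sq_sqrt hx.le]
    have h3 := mul_le_mul_of_nonneg_left h1 hx.le
    rw [mul_sub x _ 1, h2] at h3
    linarith
  have h1 := key a ha
  have h2 := key b hb
  have h3 : √(a + b) * (√a + √b) ≤ a + b + √(a * b) := by
    rw [Real.sqrt_mul ha.le]
    refine abs_le_of_sq_le_sq' ?_ (by positivity) |>.2
    rw [mul_pow, Real.sq_sqrt hs.le]
    nlinarith [Real.sq_sqrt ha.le, Real.sq_sqrt hb.le, Real.sqrt_nonneg a, Real.sqrt_nonneg b,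
      sq_nonneg (√a * √b)]
  simp only [entTerm, Real.negMulLog]
  linarith

theorem entropy_le_bhat (c : BitSource) : c.entropy ≤ c.bhat :=
  Finset.sum_le_sum fun y _ => entTerm_le (c.pos y 0) (c.pos y 1)

theorem two_mul_le_log_sub_log {t : ℝ} (h0 : 0 ≤ t) (h1 : t < 1) :
    2 * t ≤ Real.log (1 + t) - Real.log (1 - t) := by
  have h := Real.hasSum_log_sub_log_of_abs_lt_one (abs_lt.2 ⟨by linarith, h1⟩)
  have := le_hasSum h 0 fun k _ => by positivity
  simpa using this

theorem antitoneOn_binEntropy_add_sq :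
    AntitoneOn (fun t : ℝ => Real.binEntropy ((1 + t) / 2) + t ^ 2 / 2) (Set.Ico 0 1) := by
  have hd : ∀ t ∈ Set.Ico (0 : ℝ) 1, HasDerivAt
      (fun t : ℝ => Real.binEntropy ((1 + t) / 2) + t ^ 2 / 2)
      ((Real.log (1 - (1 + t) / 2) - Real.log ((1 + t) / 2)) * (1 / 2) + t) t := by
    intro t ht
    have h1 := Real.hasDerivAt_binEntropy (p := (1 + t) / 2) (by linarith [ht.1])
      (by linarith [ht.2])
    have h2 : HasDerivAt (fun t : ℝ => (1 + t) / 2) (1 / 2) t :=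
      ((hasDerivAt_id t).const_add 1).div_const 2
    have h3 : HasDerivAt (fun t : ℝ => t ^ 2 / 2) t t := by
      simpa using (hasDerivAt_pow 2 t).div_const 2
    exact (h1.comp t h2).add h3
  refine antitoneOn_of_deriv_nonpos (convex_Ico 0 1)
    (fun t ht => (hd t ht).continuousAt.continuousWithinAt)
    (fun t ht => (hd t (interior_subset ht)).differentiableAt.differentiableWithinAt) ?_
  intro t ht
  have ht' := interior_subset ht
  rw [(hd t ht').deriv]
  have h := two_mul_le_log_sub_log ht'.1 ht'.2
  have e : 1 - (1 + t) / 2 = (1 - t) / 2 := by ring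
  rw [e, Real.log_div (by linarith [ht'.2]) two_ne_zero, Real.log_div (by linarith [ht'.1])
    two_ne_zero]
  linarith

theorem binEntropy_abs (t : ℝ) : Real.binEntropy ((1 + |t|) / 2) = Real.binEntropy ((1 + t) / 2) := by
  rcases abs_cases t with ⟨h, _⟩ | ⟨h, _⟩ <;> rw [h]
  rw [← Real.binEntropy_one_sub]
  congr 1
  ring

theorem binEntropy_mul_sub_ge {s t : ℝ} (hs : |s| < 1) (ht : |t| < 1) :
    s ^ 2 * (1 - t ^ 2) / 2 ≤
      Real.binEntropy ((1 + s * t) / 2) - Real.binEntropy ((1 + s) / 2) := by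
  have h := antitoneOn_binEntropy_add_sq (a := |s * t|) (b := |s|)
    ⟨abs_nonneg _, by rw [abs_mul]; nlinarith [abs_nonneg s, abs_nonneg t]⟩ ⟨abs_nonneg _, hs⟩
    (by rw [abs_mul]; nlinarith [abs_nonneg s, abs_nonneg t])
  simp only [binEntropy_abs, sq_abs] at h
  nlinarith

theorem entropy_minus_sub_ge (c : BitSource) :
    c.sqBias * (1 - c.sqBias) / 2 ≤ c.minus.entropy - c.entropy := by
  set s : c.Y → ℝ := fun y => c.J y 0 + c.J y 1 with hs
  set t : c.Y → ℝ := fun y => (c.J y 0 - c.J y 1) / (c.J y 0 + c.J y 1) with ht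
  have hpos : ∀ y, 0 < s y := fun y => add_pos (c.pos y 0) (c.pos y 1)
  have hsum : ∑ y, s y = 1 := c.sum_eq
  have habs : ∀ y, |t y| < 1 := fun y => by
    have := c.pos y 0
    have := c.pos y 1
    have := hpos y
    rw [abs_lt]
    constructor
    · rw [ht, lt_div_iff₀ this]; linarith
    · rw [ht, div_lt_iff₀ this]; linarith
  have hm : c.sqBias = ∑ y, s y * t y ^ 2 := Finset.sum_congr rfl fun y _ => by
    have := (hpos y).ne'
    simp only [hs, ht] at this ⊢
    field_simp
  have hm1 : 1 - c.sqBias = ∑ y, s y * (1 - t y ^ 2) := by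
    simp only [mul_sub, mul_one, Finset.sum_sub_distrib, hsum, hm]
  have he : c.entropy = ∑ y₁, ∑ y₂, s y₁ * s y₂ * Real.binEntropy ((1 + t y₁) / 2) := by
    rw [entropy, functional]
    refine Finset.sum_congr rfl fun y₁ _ => ?_
    rw [entTerm_eq (c.pos _ _) (c.pos _ _), ← Finset.sum_mul, ← Finset.mul_sum, hsum, mul_one]
  have hem : c.minus.entropy =
      ∑ y₁, ∑ y₂, s y₁ * s y₂ * Real.binEntropy ((1 + t y₁ * t y₂) / 2) := by
    rw [entropy, functional_minus]
    refine Finset.sum_congr rfl fun y₁ _ => Finset.sum_congr rfl fun y₂ _ => ?_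
    have h1 := c.pos y₁ 0
    have h2 := c.pos y₁ 1
    have h3 := c.pos y₂ 0
    have h4 := c.pos y₂ 1
    rw [entTerm_eq (by positivity) (by positivity)]
    congr 1
    · simp only [hs]; ring
    · congr 3
      simp only [ht]
      rw [div_mul_div_comm]
      congr 1 <;> ring
  rw [he, hem, hm1, hm, Finset.sum_mul_sum, Finset.sum_div, ← Finset.sum_sub_distrib]
  refine Finset.sum_le_sum fun y₁ _ => ?_
  rw [Finset.sum_div, ← Finset.sum_sub_distrib]
  refine Finset.sum_le_sum fun y₂ _ => ?_
  have := mul_le_mul_of_nonneg_left (binEntropy_mul_sub_ge (habs y₁) (habs y₂))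
    (mul_pos (hpos y₁) (hpos y₂)).le
  linarith

end BitSource
end PolarSource

namespace PolarSource
namespace BitSource

/-! ## Polarization -/

/-- The average of `Ψ` over the `2 ^ n` sources that arise from `c` by `n` steps, each of which is
`minus` or `plus`. -/
noncomputable def avg (Ψ : BitSource → ℝ) : ℕ → BitSource → ℝ
  | 0, c => Ψ c
  | n + 1, c => (avg Ψ n c.minus + avg Ψ n c.plus) / 2

theorem avg_add (Ψ : BitSource → ℝ) (m n : ℕ) (c : BitSource) :
    avg Ψ (m + n) c = avg (avg Ψ n) m c := by
  induction m generalizing c with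
  | zero => rw [zero_add, avg]
  | succ m ih => rw [Nat.succ_add, avg, avg, ih, ih]

theorem avg_mono {Ψ Φ : BitSource → ℝ} (h : ∀ c, Ψ c ≤ Φ c) (n : ℕ) (c : BitSource) :
    avg Ψ n c ≤ avg Φ n c := by
  induction n generalizing c with
  | zero => exact h c
  | succ n ih =>
    simp only [avg]
    linarith [ih c.minus, ih c.plus]

theorem avg_linear (Ψ Φ : BitSource → ℝ) (a b d : ℝ) (n : ℕ) (c : BitSource) :
    avg (fun c => a * Ψ c + b * Φ c + d) n c = a * avg Ψ n c + b * avg Φ n c + d := by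
  induction n generalizing c with
  | zero => rfl
  | succ n ih =>
    simp only [avg, ih]
    ring

theorem avg_const (d : ℝ) (n : ℕ) (c : BitSource) : avg (fun _ => d) n c = d := by
  induction n generalizing c with
  | zero => rfl
  | succ n ih => simp only [avg, ih]; ring

theorem avg_entropy (n : ℕ) (c : BitSource) : avg entropy n c = c.entropy := by
  induction n generalizing c with
  | zero => rfl
  | succ n ih =>
    rw [avg, ih, ih, entropy_minus_add_plus]
    ring

/-- The squared change of entropy in one step. -/
noncomputable def sqStep (c : BitSource) : ℝ := (c.minus.entropy - c.entropy) ^ 2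

theorem avg_entropy_sq_succ (n : ℕ) (c : BitSource) :
    avg (fun c => c.entropy ^ 2) (n + 1) c =
      avg (fun c => c.entropy ^ 2) n c + avg sqStep n c := by
  induction n generalizing c with
  | zero =>
    have h : c.plus.entropy = 2 * c.entropy - c.minus.entropy := by
      linarith [c.entropy_minus_add_plus]
    simp only [avg, sqStep, h]
    ring
  | succ n ih =>
    rw [avg, ih, ih, avg, avg]
    ring

theorem exists_avg_sqStep_le (c : BitSource) {ε : ℝ} (hε : 0 < ε) : ∃ m, avg sqStep m c ≤ ε := by
  by_contra! h
  have hlow : ∀ n : ℕ, n * ε ≤ avg (fun c => c.entropy ^ 2) n c := by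
    intro n
    induction n with
    | zero => simpa [avg] using sq_nonneg c.entropy
    | succ n ih =>
      rw [avg_entropy_sq_succ]
      push_cast
      linarith [h n]
  have hup : ∀ n : ℕ, avg (fun c => c.entropy ^ 2) n c ≤ Real.log 2 ^ 2 := fun n =>
    (avg_mono (fun c => pow_le_pow_left₀ c.entropy_nonneg c.entropy_le_log_two 2) n c).trans_eq
      (avg_const _ n c)
  obtain ⟨n, hn⟩ := exists_nat_gt (Real.log 2 ^ 2 / ε)
  rw [div_lt_iff₀ hε] at hn
  linarith [hlow n, hup n]

open Classical in
/-- The indicator of the sources with bias above `τ`. -/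
noncomputable def biased (τ : ℝ) (c : BitSource) : ℝ := if τ < c.bias then 1 else 0

theorem biased_le_one (τ : ℝ) (c : BitSource) : biased τ c ≤ 1 := by
  unfold biased; split_ifs <;> norm_num

theorem biased_nonneg (τ : ℝ) (c : BitSource) : 0 ≤ biased τ c := by
  unfold biased; split_ifs <;> norm_num

theorem biased_of_le {τ : ℝ} {c : BitSource} (h : c.bias ≤ τ) : biased τ c = 0 :=
  if_neg h.not_gt

theorem entropy_sq_le (c : BitSource) : c.entropy ^ 2 ≤ 1 - c.sqBias :=
  (pow_le_pow_left₀ c.entropy_nonneg c.entropy_le_bhat 2).trans c.bhat_sq_le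

theorem biased_le {τ ε : ℝ} (hτ : 0 < τ) (hε : 0 < ε) (c : BitSource) :
    biased τ c ≤ (2 / (τ ^ 2 * (ε * Real.log 2) ^ 2)) ^ 2 * sqStep c +
      (-(Real.log 2)⁻¹) * c.entropy + (1 + ε) := by
  have hlog : 0 < Real.log 2 := Real.log_pos one_lt_two
  have hS : 0 ≤ (2 / (τ ^ 2 * (ε * Real.log 2) ^ 2)) ^ 2 * sqStep c :=
    mul_nonneg (sq_nonneg _) (sq_nonneg _)
  have hH : (Real.log 2)⁻¹ * c.entropy ≤ 1 := by
    rw [inv_mul_le_iff₀ hlog, mul_one]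
    exact c.entropy_le_log_two
  rcases le_or_gt c.bias τ with h | h
  · rw [biased_of_le h]
    linarith
  · refine (biased_le_one τ c).trans ?_
    have hm : τ ^ 2 ≤ c.sqBias :=
      (pow_le_pow_left₀ hτ.le h.le 2).trans c.bias_sq_le_sqBias
    rcases le_or_gt (1 - c.sqBias) ((ε * Real.log 2) ^ 2) with h1 | h1
    · have h2 : c.entropy ≤ ε * Real.log 2 :=
        le_of_sq_le_sq (c.entropy_sq_le.trans h1) (by positivity)
      have h3 : (Real.log 2)⁻¹ * c.entropy ≤ ε := by
        rw [inv_mul_le_iff₀ hlog]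
        linarith
      linarith
    · have h2 : τ ^ 2 * (ε * Real.log 2) ^ 2 / 2 ≤ c.minus.entropy - c.entropy := by
        refine le_trans ?_ c.entropy_minus_sub_ge
        have := mul_le_mul hm h1.le (sq_nonneg _) ((sq_nonneg _).trans hm)
        linarith
      have h3 : 1 ≤ (2 / (τ ^ 2 * (ε * Real.log 2) ^ 2)) ^ 2 * sqStep c := by
        rw [sqStep, ← mul_pow]
        refine one_le_pow₀ ?_
        rw [div_mul_eq_mul_div, one_le_div (by positivity)]
        linarith
      linarith

/-- After sufficiently many steps, the fraction of sources with a bias above a given constant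
is at most about `1 - H / log 2`. -/
theorem exists_avg_biased_le (c : BitSource) {τ ε : ℝ} (hτ : 0 < τ) (hε : 0 < ε) :
    ∃ m, avg (biased τ) m c ≤ 1 - c.entropy / Real.log 2 + ε := by
  have hlog : 0 < Real.log 2 := Real.log_pos one_lt_two
  set A := (2 / (τ ^ 2 * (ε / 2 * Real.log 2) ^ 2)) ^ 2 with hA
  have hA0 : 0 < A := by positivity
  obtain ⟨m, hm⟩ := c.exists_avg_sqStep_le (ε := ε / 2 / A) (by positivity)
  refine ⟨m, (avg_mono (biased_le hτ (half_pos hε)) m c).trans ?_⟩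
  rw [avg_linear, avg_entropy, ← hA]
  have := mul_le_mul_of_nonneg_left hm hA0.le
  rw [mul_div_cancel₀ _ hA0.ne'] at this
  rw [div_eq_inv_mul c.entropy]
  linarith

/-! ### The rate of polarization -/

theorem exists_rate {β : ℝ} (hβ0 : 0 < β) (hβ1 : β < 1 / 2) :
    ∃ s r : ℝ, 0 < s ∧ 1 < r ∧ (2 : ℝ) ^ (β * s) * (((1 / 2) ^ s + r ^ s) / 2) < 1 := by
  have hlog : 0 < Real.log 2 := Real.log_pos one_lt_two
  set z : ℝ := (1 - 2 * β) / 4 with hz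
  have hz0 : 0 < z := by rw [hz]; linarith
  have hz1 : z ≤ 1 / 4 := by rw [hz]; linarith
  set s := z / Real.log 2 with hs
  have hs0 : 0 < s := div_pos hz0 hlog
  have hsz : Real.log 2 * s = z := mul_div_cancel₀ _ hlog.ne'
  have e1 : (2 : ℝ) ^ (β * s) = Real.exp (β * z) := by
    rw [Real.rpow_def_of_pos two_pos, ← hsz]; congr 1; ring
  have e2 : (1 / 2 : ℝ) ^ s = Real.exp (-z) := by
    rw [Real.rpow_def_of_pos (by norm_num), one_div, Real.log_inv, neg_mul, hsz]
  have h1 := (abs_le.1 (Real.abs_exp_sub_one_sub_id_le (x := β * z)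
    (abs_le.2 ⟨by nlinarith, by nlinarith⟩))).2
  have h2 := (abs_le.1 (Real.abs_exp_sub_one_sub_id_le (x := β * z - z)
    (abs_le.2 ⟨by nlinarith, by nlinarith⟩))).2
  have hlt : (2 : ℝ) ^ (β * s) * (((1 / 2) ^ s + (1 : ℝ) ^ s) / 2) < 1 := by
    rw [e1, e2, Real.one_rpow, ← mul_div_assoc, mul_add, mul_one, ← Real.exp_add, ← sub_eq_add_neg]
    have hb : (β * z) ^ 2 ≤ z ^ 2 / 4 := by
      have : (β * z) ^ 2 = β ^ 2 * z ^ 2 := by ring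
      have : β ^ 2 ≤ 1 / 4 := by nlinarith
      nlinarith [sq_nonneg z]
    have hb' : (β * z - z) ^ 2 ≤ z ^ 2 := by
      have : (β * z - z) ^ 2 = (1 - β) ^ 2 * z ^ 2 := by ring
      have : (1 - β) ^ 2 ≤ 1 := by nlinarith
      nlinarith [sq_nonneg z]
    have hβz : 2 * β = 1 - 4 * z := by rw [hz]; ring
    have : 2 * (β * z) = z - 4 * z ^ 2 := by
      calc 2 * (β * z) = (2 * β) * z := by ring
        _ = _ := by rw [hβz]; ring
    nlinarith [sq_pos_of_pos hz0]
  have hcont : ContinuousAt (fun r : ℝ => (2 : ℝ) ^ (β * s) * (((1 / 2) ^ s + r ^ s) / 2)) 1 := by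
    have : ContinuousAt (fun r : ℝ => r ^ s) 1 :=
      Real.continuousAt_rpow_const 1 s (.inl one_ne_zero)
    fun_prop
  have hev := (hcont.eventually (gt_mem_nhds hlt)).filter_mono
    (nhdsWithin_le_nhds (s := Set.Ioi 1))
  obtain ⟨r, hr, hr1⟩ := (hev.and self_mem_nhdsWithin).exists
  exact ⟨s, r, hs0, hr1, hr⟩

theorem avg_biased_le {s r : ℝ} (hs : 0 < s) (hr : 1 < r) (hρ : ((1 / 2) ^ s + r ^ s) / 2 ≤ 1)
    {M : ℝ} (hM : 0 < M) (n : ℕ) : ∀ (c : BitSource) (L : ℝ), 0 < L → c.bias ≤ (2 : ℝ) ^ (-L) →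
      avg (biased ((2 : ℝ) ^ (-M))) n c ≤
        (r / (r - 1) / L) ^ s + (M / L) ^ s * (((1 / 2) ^ s + r ^ s) / 2) ^ n := by
  have hr0 : 0 < r - 1 := by linarith
  have hK : 0 < r / (r - 1) := div_pos (by linarith) hr0
  have hρ0 : 0 < ((1 / 2) ^ s + r ^ s) / 2 := by positivity
  induction n with
  | zero =>
    intro c L hL hc
    have h1 : 0 ≤ (r / (r - 1) / L) ^ s := by positivity
    rw [pow_zero, mul_one, avg]
    rcases le_or_gt M L with h | h
    · rw [biased_of_le (hc.trans (Real.rpow_le_rpow_of_exponent_le one_le_two (by linarith)))]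
      positivity
    · have h2 : 1 ≤ (M / L) ^ s := Real.one_le_rpow ((one_le_div hL).2 h.le) hs.le
      linarith [biased_le_one ((2 : ℝ) ^ (-M)) c]
  | succ n ih =>
    intro c L hL hc
    rcases le_or_gt L (r / (r - 1)) with h | h
    · have h1 : 1 ≤ (r / (r - 1) / L) ^ s := Real.one_le_rpow ((one_le_div hL).2 h) hs.le
      have h2 : 0 ≤ (M / L) ^ s * (((1 / 2) ^ s + r ^ s) / 2) ^ (n + 1) := by positivity
      have h3 := avg_mono (biased_le_one ((2 : ℝ) ^ (-M))) (n + 1) c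
      rw [avg_const] at h3
      linarith
    · have hL1 : 1 < L := lt_trans ((one_lt_div hr0).2 (by linarith)) h
      have hminus : c.minus.bias ≤ (2 : ℝ) ^ (-(2 * L)) := by
        rw [bias_minus]
        refine (pow_le_pow_left₀ c.bias_nonneg hc 2).trans_eq ?_
        rw [← Real.rpow_mul_natCast two_pos.le]
        congr 1
        push_cast
        ring
      have hplus : c.plus.bias ≤ (2 : ℝ) ^ (-(L - 1)) := by
        refine c.bias_plus_le.trans ((mul_le_mul_of_nonneg_left hc two_pos.le).trans_eq ?_)
        rw [neg_sub, sub_eq_add_neg, Real.rpow_add two_pos, Real.rpow_one]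
      have h1 := ih c.minus (2 * L) (by linarith) hminus
      have h2 := ih c.plus (L - 1) (by linarith) hplus
      have hmul : ∀ x : ℝ, 0 < x → (x / (2 * L)) ^ s = (1 / 2) ^ s * (x / L) ^ s := by
        intro x hx
        rw [← Real.mul_rpow (by norm_num) (by positivity)]
        congr 1
        field_simp
      have hmul' : ∀ x : ℝ, 0 < x → (x / (L - 1)) ^ s ≤ r ^ s * (x / L) ^ s := by
        intro x hx
        rw [← Real.mul_rpow (by linarith) (by positivity)]
        refine Real.rpow_le_rpow (div_nonneg hx.le (by linarith)) ?_ hs.le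
        rw [← mul_div_assoc, div_le_div_iff₀ (by linarith) hL]
        rw [div_lt_iff₀ hr0] at h
        nlinarith
      rw [hmul _ hK, hmul _ hM] at h1
      have h3 := hmul' _ hK
      have h4 := mul_le_mul_of_nonneg_right (hmul' _ hM) (pow_nonneg hρ0.le n)
      have h5 : 0 ≤ (r / (r - 1) / L) ^ s := by positivity
      have h6 := mul_le_mul_of_nonneg_right hρ h5
      rw [avg, pow_succ]
      nlinarith

open Filter Topology in
/-- Arbitrarily small fractions aside, the fraction of sources with a bias that is not doubly
exponentially small is at most `1 - H / log 2`. -/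
theorem eventually_avg_biased_le (c : BitSource) {β C ε : ℝ} (hβ0 : 0 < β) (hβ1 : β < 1 / 2)
    (hε : 0 < ε) {M : ℕ → ℝ} (hM0 : ∀ n, 0 < M n) (hM : ∀ n, M n ≤ C * (2 : ℝ) ^ (β * n)) :
    ∀ᶠ n in atTop, avg (biased ((2 : ℝ) ^ (-M n))) n c ≤ 1 - c.entropy / Real.log 2 + ε := by
  obtain ⟨s, r, hs, hr, hρ⟩ := exists_rate hβ0 hβ1
  set ρ : ℝ := ((1 / 2) ^ s + r ^ s) / 2 with hρdef
  have hρ0 : 0 < ρ := by positivity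
  have hb1 : 1 ≤ (2 : ℝ) ^ (β * s) := Real.one_le_rpow one_le_two (by positivity)
  have hρ1 : ρ ≤ 1 := by nlinarith
  have hK : 0 < r / (r - 1) := div_pos (by linarith) (by linarith)
  have hC : 0 < C := by
    have := (hM0 0).trans_le (hM 0)
    simpa using this
  -- the initial exponent
  obtain ⟨L, hL, hLε⟩ : ∃ L : ℝ, 0 < L ∧ (r / (r - 1) / L) ^ s ≤ ε / 3 := by
    refine ⟨r / (r - 1) / (ε / 3) ^ (1 / s), by positivity, le_of_eq ?_⟩
    rw [div_div_cancel₀ hK.ne', ← Real.rpow_mul (by positivity), one_div_mul_cancel hs.ne',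
      Real.rpow_one]
  obtain ⟨m, hm⟩ := c.exists_avg_biased_le (τ := (2 : ℝ) ^ (-L)) (ε := ε / 3) (by positivity)
    (by positivity)
  have hlim : Tendsto (fun n : ℕ => (C / L) ^ s * (ρ ^ m)⁻¹ * ((2 : ℝ) ^ (β * s) * ρ) ^ n) atTop
      (𝓝 0) := by
    have := (tendsto_pow_atTop_nhds_zero_of_lt_one (by positivity) hρ).const_mul
      ((C / L) ^ s * (ρ ^ m)⁻¹)
    rwa [mul_zero] at this
  filter_upwards [hlim.eventually (gt_mem_nhds (show (0 : ℝ) < ε / 3 by positivity)),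
    eventually_ge_atTop m] with n hn hmn
  obtain ⟨k, rfl⟩ := Nat.exists_eq_add_of_le hmn
  have hbound : (M (m + k) / L) ^ s * ρ ^ k ≤ ε / 3 := by
    refine le_trans ?_ hn.le
    have h1 : (M (m + k) / L) ^ s ≤ (C / L) ^ s * ((2 : ℝ) ^ (β * s)) ^ (m + k) := by
      have e : ((2 : ℝ) ^ (β * s)) ^ (m + k) = ((2 : ℝ) ^ (β * (m + k : ℕ))) ^ s := by
        rw [← Real.rpow_mul_natCast two_pos.le, ← Real.rpow_mul two_pos.le]
        congr 1
        ring
      rw [e, ← Real.mul_rpow (by positivity) (by positivity)]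
      refine Real.rpow_le_rpow (div_nonneg (hM0 _).le hL.le) ?_ hs.le
      rw [div_mul_eq_mul_div]
      exact div_le_div_of_nonneg_right (hM _) hL.le
    refine (mul_le_mul_of_nonneg_right h1 (pow_nonneg hρ0.le k)).trans_eq ?_
    rw [mul_pow _ ρ, pow_add ρ]
    have := (pow_pos hρ0 m).ne'
    field_simp
  rw [avg_add]
  have hpt : ∀ d : BitSource, avg (biased ((2 : ℝ) ^ (-M (m + k)))) k d ≤
      1 * biased ((2 : ℝ) ^ (-L)) d + 0 * biased 0 d + (ε / 3 + ε / 3) := by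
    intro d
    rcases le_or_gt d.bias ((2 : ℝ) ^ (-L)) with h | h
    · have := avg_biased_le hs hr hρ1 (hM0 (m + k)) k d L hL h
      rw [biased_of_le h]
      linarith
    · have h1 := avg_mono (biased_le_one ((2 : ℝ) ^ (-M (m + k)))) k d
      rw [avg_const] at h1
      rw [biased, if_pos h]
      linarith
  refine (avg_mono hpt m c).trans ?_
  rw [avg_linear]
  linarith

end BitSource
end PolarSource

namespace PolarSource
open Matrix

/-! ## The synthesized channels as sources -/

namespace BitSource

/-- The weights of the code bits, given the side information `y`. -/
def weight (c : BitSource) {n : ℕ} (y : Fin (2 ^ n) → c.Y) (j : Fin (2 ^ n)) (x : ZMod 2) : ℝ :=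
  c.J (y j) x

/-- The source of the bit `uᵢ` with side information `y` and `u₀, …, u_{i-1}`, up to a relabeling of
the side information. -/
noncomputable def synth : (n : ℕ) → Fin (2 ^ n) → BitSource → BitSource
  | 0, _, c => c
  | n + 1, i, c =>
    if h : (i : ℕ) < 2 ^ n then synth n ⟨i, h⟩ c.minus
    else synth n ⟨i - 2 ^ n, by have := i.isLt; omega⟩ c.plus

theorem synth_lowerHalf {n : ℕ} (i : Fin (2 ^ n)) (c : BitSource) :
    synth (n + 1) (lowerHalf i) c = synth n i c.minus := by
  exact dif_pos i.isLt

theorem synth_upperHalf {n : ℕ} (i : Fin (2 ^ n)) (c : BitSource) :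
    synth (n + 1) (upperHalf i) c = synth n i c.plus := by
  refine (dif_neg (by simp)).trans ?_
  congr 1
  simp

theorem sum_synth (Ψ : BitSource → ℝ) (n : ℕ) (c : BitSource) :
    ∑ i, Ψ (synth n i c) = 2 ^ n * avg Ψ n c := by
  induction n generalizing c with
  | zero =>
    refine (Fin.sum_univ_one fun i => Ψ (synth 0 i c)).trans ?_
    simp [synth, avg]
  | succ n ih =>
    rw [sum_halves]
    simp only [synth_lowerHalf, synth_upperHalf, ih, avg]
    ring

theorem functional_synth (Φ : ℝ → ℝ → ℝ) {n : ℕ} (i : Fin (2 ^ n)) (c : BitSource) :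
    (synth n i c).functional Φ = ∑ y : Fin (2 ^ n) → c.Y, ∑ p : Fin (i : ℕ) → ZMod 2,
      Φ (prefixWeight (c.weight y) (i + 1) (Fin.snoc p 0))
        (prefixWeight (c.weight y) (i + 1) (Fin.snoc p 1)) := by
  induction n generalizing c with
  | zero =>
    obtain rfl : i = 0 := Subsingleton.elim (α := Fin 1) _ _
    have hw : ∀ (y : Fin (2 ^ 0) → c.Y) (p : Fin ((0 : Fin (2 ^ 0)) : ℕ) → ZMod 2) (b : ZMod 2),
        prefixWeight (c.weight y) (((0 : Fin (2 ^ 0)) : ℕ) + 1) (Fin.snoc p b) = c.J (y 0) b := by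
      intro y p b
      refine (prefixWeight_full (c.weight y) _).trans ?_
      rw [vecMul_polarMatrix_zero]
      exact Fin.prod_univ_one fun i => c.J (y i) ((Fin.snoc p b : Fin (2 ^ 0) → ZMod 2) i)
    have h1 : ∀ y : Fin (2 ^ 0) → c.Y, ∑ p : Fin ((0 : Fin (2 ^ 0)) : ℕ) → ZMod 2,
        Φ (prefixWeight (c.weight y) (((0 : Fin (2 ^ 0)) : ℕ) + 1) (Fin.snoc p 0))
          (prefixWeight (c.weight y) (((0 : Fin (2 ^ 0)) : ℕ) + 1) (Fin.snoc p 1)) =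
        Φ (c.J (y 0) 0) (c.J (y 0) 1) := fun y => by
      simp only [hw]
      exact Fintype.sum_unique (ι := Fin 0 → ZMod 2) fun _ => Φ (c.J (y 0) 0) (c.J (y 0) 1)
    rw [Finset.sum_congr rfl fun y _ => h1 y]
    exact ((Equiv.funUnique (Fin 1) c.Y).sum_comp fun y => Φ (c.J y 0) (c.J y 1)).symm
  | succ n ih =>
    have hsplit : ∀ g : (Fin (2 ^ (n + 1)) → c.Y) → ℝ,
        ∑ z : Fin (2 ^ n) → c.Y × c.Y, g (interleave (fun j => (z j).1) fun j => (z j).2) =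
          ∑ y, g y := fun g =>
      ((Equiv.arrowProdEquivProdArrow (Fin (2 ^ n)) (fun _ => c.Y) (fun _ => c.Y)).trans
        (interleaveEquiv n c.Y)).sum_comp g
    rcases half_cases i with ⟨i, rfl⟩ | ⟨i, rfl⟩
    · have hf : ∀ z : Fin (2 ^ n) → c.Y × c.Y,
          checkWeight (c.weight (interleave (fun j => (z j).1) fun j => (z j).2)) =
          c.minus.weight z := by
        intro z
        funext j a
        simp only [checkWeight, weight, interleave_evenIdx, interleave_oddIdx, minus]
      have hp : ∀ (z : Fin (2 ^ n) → c.Y × c.Y) (p : Fin (i : ℕ) → ZMod 2) (b : ZMod 2),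
          prefixWeight (c.minus.weight z) (i + 1) (Fin.snoc p b) =
          prefixWeight (c.weight (interleave (fun j => (z j).1) fun j => (z j).2))
            ((lowerHalf i : ℕ) + 1) (Fin.snoc p b) := fun z p b =>
        (congrArg (fun f => prefixWeight f (i + 1) (Fin.snoc p b)) (hf z)).symm.trans
          (prefixWeight_checkWeight _ i.isLt _).symm
      rw [synth_lowerHalf, ih, ← hsplit]
      exact Finset.sum_congr rfl fun z _ => Finset.sum_congr rfl fun p _ =>
        congrArg₂ Φ (hp z p 0) (hp z p 1)
    · have hf : ∀ (z : Fin (2 ^ n) → c.Y × c.Y) (a : Fin (2 ^ n) → ZMod 2),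
          variableWeight (c.weight (interleave (fun j => (z j).1) fun j => (z j).2)) a =
          c.plus.weight fun j => (z j, a j) := by
        intro z a
        funext j b
        simp only [variableWeight, weight, interleave_evenIdx, interleave_oddIdx, plus]
      have hp : ∀ (z : Fin (2 ^ n) → c.Y × c.Y) (a : Fin (2 ^ n) → ZMod 2)
          (q : Fin (i : ℕ) → ZMod 2) (b : ZMod 2),
          prefixWeight (c.plus.weight fun j => (z j, transformEquiv n a j)) (i + 1)
            (Fin.snoc q b) =
          prefixWeight (c.weight (interleave (fun j => (z j).1) fun j => (z j).2))
            ((upperHalf i : ℕ) + 1) (Fin.snoc (Fin.append a q) b) := by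
        intro z a q b
        rw [transformEquiv_apply, ← hf, ← prefixWeight_variableWeight, Fin.append_snoc]
        rfl
      rw [synth_upperHalf, ih, ← hsplit]
      refine ((Equiv.arrowProdEquivProdArrow (Fin (2 ^ n)) (fun _ => c.Y × c.Y)
        fun _ => ZMod 2).symm.sum_comp fun y : Fin (2 ^ n) → (c.Y × c.Y) × ZMod 2 =>
          ∑ p : Fin (i : ℕ) → ZMod 2,
            Φ (prefixWeight (c.plus.weight y) (i + 1) (Fin.snoc p 0))
              (prefixWeight (c.plus.weight y) (i + 1) (Fin.snoc p 1))).symm.trans ?_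
      refine (Fintype.sum_prod_type _).trans (Finset.sum_congr rfl fun z _ => ?_)
      refine ((transformEquiv n).sum_comp _).symm.trans ?_
      refine Eq.trans ?_ ((Fin.appendEquiv (α := ZMod 2) (2 ^ n) i).sum_comp fun p =>
        Φ (prefixWeight (c.weight (interleave (fun j => (z j).1) fun j => (z j).2))
            ((upperHalf i : ℕ) + 1) (Fin.snoc p 0))
          (prefixWeight (c.weight (interleave (fun j => (z j).1) fun j => (z j).2))
            ((upperHalf i : ℕ) + 1) (Fin.snoc p 1)))
      refine Eq.trans ?_ (Fintype.sum_prod_type _).symm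
      exact Finset.sum_congr rfl fun a _ => Finset.sum_congr rfl fun q _ =>
        congrArg₂ Φ (hp z a q 0) (hp z a q 1)

end BitSource

/-- A uniform bit observed through the binary symmetric channel. -/
noncomputable def bscSource (D : ℝ) (hD0 : 0 < D) (hD1 : D < 1) : BitSource where
  Y := ZMod 2
  fin := inferInstance
  J y x := 1 / 2 * bsc D y x
  pos y x := mul_pos (by norm_num) (bsc_pos hD0 hD1 y x)
  sum_eq := by
    rw [sum_bits]
    simp only [bsc, if_true, zero_ne_one, one_ne_zero, if_false]
    ring

theorem entropy_bscSource {D : ℝ} (hD0 : 0 < D) (hD1 : D < 1) :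
    (bscSource D hD0 hD1).entropy = Real.binEntropy D := by
  have h1 : ∀ a b : ℝ, 0 < a → 0 < b → a + b = 1 →
      BitSource.entTerm (1 / 2 * a) (1 / 2 * b) = 1 / 2 * Real.binEntropy a := by
    intro a b ha hb hab
    rw [BitSource.entTerm_eq (by positivity) (by positivity), ← mul_add, ← mul_sub, hab,
      mul_one]
    congr 2
    have : b = 1 - a := by linarith
    subst this
    field_simp
    ring
  have h0 : ∀ b, bsc D b b = 1 - D := fun b => if_pos rfl
  have h01 : bsc D 0 1 = D := if_neg (by decide)
  have h10 : bsc D 1 0 = D := if_neg (by decide)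
  refine (sum_bits fun y => BitSource.entTerm (1 / 2 * bsc D y 0) (1 / 2 * bsc D y 1)).trans ?_
  simp only [h0, h01, h10]
  rw [h1 _ _ (by linarith) hD0 (by ring), h1 _ _ hD0 (by linarith) (by ring),
    Real.binEntropy_one_sub]
  ring

theorem prefixWeight_bscSource {D : ℝ} (hD0 : 0 < D) (hD1 : D < 1) {n : ℕ}
    (y : Fin (2 ^ n) → ZMod 2) (k : ℕ) (p : Fin k → ZMod 2) :
    prefixWeight ((bscSource D hD0 hD1).weight y) k p =
      (1 / 2) ^ 2 ^ n * prefixWeight (fun j => bsc D (y j)) k p :=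
  prefixWeight_const_mul _ _ _ _

theorem bhattacharyya_eq {D : ℝ} (hD0 : 0 < D) (hD1 : D < 1) {n : ℕ} (i : Fin (2 ^ n)) :
    bhattacharyya D i = (BitSource.synth n i (bscSource D hD0 hD1)).bhat := by
  have hs : ∀ (y : Fin (2 ^ n) → ZMod 2) (p : Fin (i : ℕ) → ZMod 2) (b : ZMod 2),
      synthChannel D i y p b =
        2 * prefixWeight ((bscSource D hD0 hD1).weight y) (i + 1) (Fin.snoc p b) := by
    intro y p b
    rw [synthChannel_eq, prefixWeight_bscSource, ← mul_assoc]
    congr 1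
    have : 2 ^ n = (2 ^ n - 1) + 1 := (Nat.sub_add_cancel Nat.one_le_two_pow).symm
    conv_rhs => rw [this, pow_succ, _root_.one_div_pow]
    ring
  rw [BitSource.bhat, BitSource.functional_synth]
  refine Finset.sum_congr rfl fun (y : Fin (2 ^ n) → ZMod 2) _ =>
    Finset.sum_congr rfl fun p _ => ?_
  rw [hs, hs, mul_mul_mul_comm, Real.sqrt_mul (by norm_num), Real.sqrt_mul_self two_pos.le]

theorem bias_synth_bscSource {D : ℝ} (hD0 : 0 < D) (hD1 : D < 1) {n : ℕ} (i : Fin (2 ^ n)) :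
    (BitSource.synth n i (bscSource D hD0 hD1)).bias = (1 / 2) ^ 2 ^ n *
      ∑ y : Fin (2 ^ n) → ZMod 2, ∑ p : Fin (i : ℕ) → ZMod 2,
        |prefixWeight (fun j => bsc D (y j)) (i + 1) (Fin.snoc p 0) -
          prefixWeight (fun j => bsc D (y j)) (i + 1) (Fin.snoc p 1)| := by
  rw [BitSource.bias, BitSource.functional_synth, Finset.mul_sum]
  refine Finset.sum_congr rfl fun (y : Fin (2 ^ n) → ZMod 2) _ => ?_
  rw [Finset.mul_sum]
  refine Finset.sum_congr rfl fun p _ => ?_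
  have h := fun b => prefixWeight_bscSource hD0 hD1 y (i + 1) (Fin.snoc p b)
  rw [h, h, ← mul_sub, abs_mul, abs_of_pos (by positivity)]

end PolarSource

namespace PolarSource
open Matrix

/-! ## Products of conditional probabilities -/

/-- The product of the conditional probabilities `κ` along the word `p`. -/
noncomputable def seqProd (κ : (k : ℕ) → (Fin k → ZMod 2) → ZMod 2 → ℝ) :
    (k : ℕ) → (Fin k → ZMod 2) → ℝ
  | 0, _ => 1
  | k + 1, p => seqProd κ k (Fin.init p) * κ k (Fin.init p) (p (Fin.last k))

theorem seqProd_snoc (κ : (k : ℕ) → (Fin k → ZMod 2) → ZMod 2 → ℝ) (k : ℕ) (p : Fin k → ZMod 2)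
    (b : ZMod 2) : seqProd κ (k + 1) (Fin.snoc p b) = seqProd κ k p * κ k p b := by
  rw [seqProd, Fin.init_snoc, Fin.snoc_last]

theorem seqProd_eq_prod (κ : (k : ℕ) → (Fin k → ZMod 2) → ZMod 2 → ℝ) (k : ℕ)
    (p : Fin k → ZMod 2) :
    seqProd κ k p = ∏ i : Fin k, κ i (fun j => p ⟨j, j.isLt.trans i.isLt⟩) (p i) := by
  induction k with
  | zero => rfl
  | succ k ih =>
    rw [seqProd, ih, Fin.prod_univ_castSucc]
    rfl

theorem sum_snoc {M : Type*} [AddCommMonoid M] {k : ℕ} (f : (Fin (k + 1) → ZMod 2) → M) :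
    ∑ p, f p = ∑ p : Fin k → ZMod 2, ∑ b, f (Fin.snoc p b) := by
  rw [← (Fin.snocEquiv fun _ => ZMod 2).sum_comp, Fintype.sum_prod_type, Finset.sum_comm]
  rfl

theorem toReal_seqLaw (κ : (k : ℕ) → (Fin k → ZMod 2) → PMF (ZMod 2)) (k : ℕ)
    (p : Fin k → ZMod 2) :
    (seqLaw κ k p).toReal = seqProd (fun k p b => (κ k p b).toReal) k p := by
  induction k with
  | zero =>
    rw [Subsingleton.elim p Fin.elim0]
    simp [seqLaw, seqProd]
  | succ k ih =>
    obtain ⟨⟨b, p⟩, rfl⟩ := (Fin.snocEquiv fun _ => ZMod 2).surjective p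
    change (seqLaw κ (k + 1) (Fin.snoc p b)).toReal = seqProd _ _ (Fin.snoc p b)
    rw [seqProd_snoc, ← ih, ← ENNReal.toReal_mul, seqLaw, PMF.bind_apply, tsum_eq_single p]
    · rw [PMF.map_apply, tsum_eq_single b]
      · rw [if_pos rfl]
      · exact fun b' hb => if_neg fun h => hb (Fin.snoc_inj.1 h).2.symm
    · intro p' hp
      rw [PMF.map_apply, ENNReal.tsum_eq_zero.2, mul_zero]
      exact fun b' => if_neg fun h => hp (Fin.snoc_inj.1 h).1.symm

/-- The distance of two laws is at most the sum of the expected distances of their conditional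
laws. -/
theorem sum_abs_seqProd_sub_le (κ κ' : (k : ℕ) → (Fin k → ZMod 2) → ZMod 2 → ℝ) (N : ℕ)
    (h : ∀ k < N, ∀ p, ∑ b, |κ' k p b| ≤ 1) :
    ∑ p, |seqProd κ N p - seqProd κ' N p| ≤
      ∑ k ∈ Finset.range N, ∑ p, |seqProd κ k p| * ∑ b, |κ k p b - κ' k p b| := by
  induction N with
  | zero => simp [seqProd]
  | succ N ih =>
    rw [sum_snoc, Finset.sum_range_succ]
    refine le_trans ?_ (add_le_add_left (ih fun k hk => h k (hk.trans N.lt_succ_self)) _)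
    rw [← Finset.sum_add_distrib]
    refine Finset.sum_le_sum fun p _ => ?_
    calc ∑ b, |seqProd κ (N + 1) (Fin.snoc p b) - seqProd κ' (N + 1) (Fin.snoc p b)|
        ≤ ∑ b, (|seqProd κ N p - seqProd κ' N p| * |κ' N p b| +
            |seqProd κ N p| * |κ N p b - κ' N p b|) := by
          refine Finset.sum_le_sum fun b _ => ?_
          rw [seqProd_snoc, seqProd_snoc, ← abs_mul, ← abs_mul]
          refine (le_of_eq ?_).trans (abs_add_le _ _)
          congr 1
          ring
      _ ≤ _ := by
          rw [Finset.sum_add_distrib, ← Finset.mul_sum, ← Finset.mul_sum]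
          have := mul_le_mul_of_nonneg_left (h N N.lt_succ_self p)
            (abs_nonneg (seqProd κ N p - seqProd κ' N p))
          linarith

/-- The conditional probability of `b` after the prefix `p`. -/
noncomputable def condProb {n : ℕ} (f : Fin (2 ^ n) → ZMod 2 → ℝ) (k : ℕ) (p : Fin k → ZMod 2)
    (b : ZMod 2) : ℝ :=
  prefixWeight f (k + 1) (Fin.snoc p b) / prefixWeight f k p

theorem seqProd_condProb {n : ℕ} {f : Fin (2 ^ n) → ZMod 2 → ℝ} (hf : ∀ i b, 0 < f i b)
    (hsum : ∀ i, ∑ b, f i b = 1) (k : ℕ) (p : Fin k → ZMod 2) :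
    seqProd (condProb f) k p = prefixWeight f k p := by
  induction k with
  | zero =>
    rw [prefixWeight_zero, Finset.prod_congr rfl fun i _ => hsum i, Finset.prod_const_one]
    rfl
  | succ k ih =>
    obtain ⟨⟨b, p⟩, rfl⟩ := (Fin.snocEquiv fun _ => ZMod 2).surjective p
    change seqProd _ (k + 1) (Fin.snoc p b) = prefixWeight _ _ (Fin.snoc p b)
    rw [seqProd_snoc, ih, condProb, mul_div_cancel₀ _ (prefixWeight_pos hf k p).ne']

theorem sum_condProb {n : ℕ} {f : Fin (2 ^ n) → ZMod 2 → ℝ} (hf : ∀ i b, 0 < f i b) {k : ℕ}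
    (hk : k < 2 ^ n) (p : Fin k → ZMod 2) : ∑ b, condProb f k p b = 1 := by
  simp only [condProb]
  rw [← Finset.sum_div, prefixWeight_snoc_add f hk, div_self (prefixWeight_pos hf k p).ne']

theorem toReal_coin {x : ℝ} (h0 : 0 ≤ x) (h1 : x ≤ 1) (b : ZMod 2) :
    (coin x b).toReal = if b = 0 then x else 1 - x := by
  rw [coin, PMF.ofFintype_apply, min_eq_right h1, max_eq_right h0]
  split_ifs
  · exact ENNReal.toReal_ofReal h0
  · exact ENNReal.toReal_ofReal (by linarith)

theorem toReal_coin_weightRatio {n : ℕ} {f : Fin (2 ^ n) → ZMod 2 → ℝ} (hf : ∀ i b, 0 < f i b)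
    {k : ℕ} (hk : k < 2 ^ n) (p : Fin k → ZMod 2) (b : ZMod 2) :
    (coin (weightRatio f k p / (1 + weightRatio f k p)) b).toReal = condProb f k p b := by
  have h := prefixWeight_snoc_add f hk p
  rw [sum_bits] at h
  have h0 := prefixWeight_pos hf (k + 1) (Fin.snoc p 0)
  have h1 := prefixWeight_pos hf (k + 1) (Fin.snoc p 1)
  have e : weightRatio f k p / (1 + weightRatio f k p) = condProb f k p 0 := by
    rw [condProb, ← h, weightRatio]
    field_simp
    ring
  rw [e, toReal_coin]
  · rcases bit_cases b with rfl | rfl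
    · rfl
    · rw [if_neg one_ne_zero, condProb, condProb, ← h]
      field_simp
      ring
  · exact div_nonneg h0.le (prefixWeight_pos hf _ _).le
  · rw [condProb, ← h]
    exact div_le_one_of_le₀ (by linarith) (by linarith)

/-! ## Expected distortion -/

/-- The conditional probabilities of successive cancellation with frozen values `w`. -/
noncomputable def frozenProb {n : ℕ} (F : Finset (Fin (2 ^ n))) (w : Fin (2 ^ n) → ZMod 2)
    (f : Fin (2 ^ n) → ZMod 2 → ℝ) (k : ℕ) (p : Fin k → ZMod 2) (b : ZMod 2) : ℝ :=
  if h : k < 2 ^ n then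
    if (⟨k, h⟩ : Fin (2 ^ n)) ∈ F then if b = w ⟨k, h⟩ then 1 else 0 else condProb f k p b
  else 0

/-- The conditional probabilities of successive cancellation with uniformly random frozen
values. -/
noncomputable def uniformProb {n : ℕ} (F : Finset (Fin (2 ^ n)))
    (f : Fin (2 ^ n) → ZMod 2 → ℝ) (k : ℕ) (p : Fin k → ZMod 2) (b : ZMod 2) : ℝ :=
  if h : k < 2 ^ n then
    if (⟨k, h⟩ : Fin (2 ^ n)) ∈ F then 1 / 2 else condProb f k p b
  else 0

theorem seqProd_congr {κ κ' : (k : ℕ) → (Fin k → ZMod 2) → ZMod 2 → ℝ} {m : ℕ}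
    (h : ∀ k < m, ∀ p b, κ k p b = κ' k p b) (p : Fin m → ZMod 2) :
    seqProd κ m p = seqProd κ' m p := by
  rw [seqProd_eq_prod, seqProd_eq_prod]
  exact Finset.prod_congr rfl fun i _ => h i i.isLt _ _

theorem toReal_scPrefix {D : ℝ} (hD0 : 0 < D) (hD1 : D < 1) {n : ℕ} (F : Finset (Fin (2 ^ n)))
    (w y u : Fin (2 ^ n) → ZMod 2) :
    (scPrefix D F w y (2 ^ n) le_rfl u).toReal =
      seqProd (frozenProb F w fun j => bsc D (y j)) (2 ^ n) u := by
  rw [scPrefix_eq, toReal_seqLaw]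
  refine seqProd_congr (fun k hk p b => ?_) u
  rw [scStep, dif_pos hk, frozenProb, dif_pos hk]
  by_cases h : (⟨k, hk⟩ : Fin (2 ^ n)) ∈ F
  · simp only [frozenBits, if_pos h, PMF.pure_apply]
    split_ifs <;> simp
  · simp only [frozenBits, if_neg h]
    exact toReal_coin_weightRatio (fun i b => bsc_pos hD0 hD1 _ _) hk p b

theorem sum_map_toReal {α γ : Type} [Fintype α] [Fintype γ] (P : PMF α) (g : α → γ) (ψ : γ → ℝ) :
    ∑ v, (P.map g v).toReal * ψ v = ∑ u, (P u).toReal * ψ (g u) := by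
  classical
  have h : ∀ v, (P.map g v).toReal = ∑ u, if v = g u then (P u).toReal else 0 := by
    intro v
    rw [PMF.map_apply, tsum_fintype, ENNReal.toReal_sum]
    · refine Finset.sum_congr rfl fun u _ => ?_
      split_ifs <;> rfl
    · intro u _
      split_ifs
      · exact P.apply_ne_top u
      · exact ENNReal.zero_ne_top
  simp only [h, Finset.sum_mul]
  rw [Finset.sum_comm]
  refine Finset.sum_congr rfl fun u _ => ?_
  simp only [ite_mul, zero_mul, Finset.sum_ite_eq', Finset.mem_univ, if_true]

/-- The distortion per symbol when `u` is used to describe `y`. -/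
noncomputable def distortion {n : ℕ} (y u : Fin (2 ^ n) → ZMod 2) : ℝ :=
  (hammingDist y (u ᵥ* polarMatrix n) : ℝ) / 2 ^ n

theorem distortion_nonneg {n : ℕ} (y u : Fin (2 ^ n) → ZMod 2) : 0 ≤ distortion y u := by
  unfold distortion; positivity

theorem distortion_le_one {n : ℕ} (y u : Fin (2 ^ n) → ZMod 2) : distortion y u ≤ 1 := by
  refine div_le_one_of_le₀ ?_ (by positivity)
  have h := hammingDist_le_card_fintype (x := y) (y := u ᵥ* polarMatrix n)
  rw [Fintype.card_fin] at h
  exact_mod_cast h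

theorem expectedDistortion_eq {D : ℝ} (hD0 : 0 < D) (hD1 : D < 1) {n : ℕ}
    (F : Finset (Fin (2 ^ n))) (w : Fin (2 ^ n) → ZMod 2) :
    expectedDistortion D F w = (1 / 2) ^ 2 ^ n * ∑ y : Fin (2 ^ n) → ZMod 2, ∑ u,
      seqProd (frozenProb F w fun j => bsc D (y j)) (2 ^ n) u * distortion y u := by
  rw [expectedDistortion, Finset.mul_sum]
  refine Finset.sum_congr rfl fun y _ => ?_
  rw [_root_.one_div_pow, scEncoder, sum_map_toReal]
  congr 1
  refine Finset.sum_congr rfl fun u _ => ?_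
  rw [toReal_scPrefix hD0 hD1]
  by_cases h : ∀ i ∈ F, u i = w i
  · have : fillFrozen F w (fun i : {i // i ∉ F} => u i) = u := by
      funext i
      unfold fillFrozen
      split_ifs with hi
      · exact (h i hi).symm
      · rfl
    rw [decoder, this]
    rfl
  · push Not at h
    obtain ⟨i, hi, hne⟩ := h
    have : seqProd (frozenProb F w fun j => bsc D (y j)) (2 ^ n) u = 0 := by
      rw [seqProd_eq_prod]
      refine Finset.prod_eq_zero (Finset.mem_univ i) ?_
      rw [frozenProb, dif_pos i.isLt, if_pos hi, if_neg hne]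
    rw [this, zero_mul, zero_mul]

/-- The first `k` entries of a word. -/
def takePrefix {n : ℕ} (w : Fin (2 ^ n) → ZMod 2) (k : ℕ) (j : Fin k) : ZMod 2 :=
  if h : (j : ℕ) < 2 ^ n then w ⟨j, h⟩ else 0

theorem bsc_add (D : ℝ) (y x z : ZMod 2) : bsc D (y + z) (x + z) = bsc D y x := by
  simp [bsc]

theorem prefixWeight_shift (D : ℝ) {n : ℕ} (y w : Fin (2 ^ n) → ZMod 2) (k : ℕ)
    (p : Fin k → ZMod 2) :
    prefixWeight (fun j => bsc D ((y + w ᵥ* polarMatrix n) j)) k (p + takePrefix w k) =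
      prefixWeight (fun j => bsc D (y j)) k p := by
  unfold prefixWeight
  rw [← Equiv.sum_comp (Equiv.addRight w)]
  refine Finset.sum_congr rfl fun u _ => if_congr ?_ ?_ rfl
  · refine forall_congr' fun j => forall_congr' fun h => ?_
    simp [takePrefix, h]
  · refine Finset.prod_congr rfl fun i _ => ?_
    simp only [Equiv.coe_addRight, add_vecMul, Pi.add_apply, bsc_add]

theorem condProb_shift (D : ℝ) {n : ℕ} (y w : Fin (2 ^ n) → ZMod 2) {k : ℕ} (hk : k < 2 ^ n)
    (p : Fin k → ZMod 2) (b : ZMod 2) :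
    condProb (fun j => bsc D ((y + w ᵥ* polarMatrix n) j)) k (p + takePrefix w k) (b + w ⟨k, hk⟩) =
      condProb (fun j => bsc D (y j)) k p b := by
  have h : (Fin.snoc (p + takePrefix w k) (b + w ⟨k, hk⟩) : Fin (k + 1) → ZMod 2) =
      Fin.snoc p b + takePrefix w (k + 1) := by
    funext j
    refine Fin.lastCases ?_ (fun j => ?_) j
    · simp [takePrefix, hk]
    · simp [takePrefix]
  unfold condProb
  rw [h, prefixWeight_shift, prefixWeight_shift]

theorem distortion_shift {n : ℕ} (y u w : Fin (2 ^ n) → ZMod 2) :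
    distortion (y + w ᵥ* polarMatrix n) (u + w) = distortion y u := by
  unfold distortion
  rw [add_vecMul]
  congr 2
  unfold hammingDist
  simp

theorem seqProd_frozenProb_shift (D : ℝ) {n : ℕ} (F : Finset (Fin (2 ^ n)))
    (y w u : Fin (2 ^ n) → ZMod 2) :
    seqProd (frozenProb F w fun j => bsc D ((y + w ᵥ* polarMatrix n) j)) (2 ^ n) (u + w) =
      seqProd (frozenProb F 0 fun j => bsc D (y j)) (2 ^ n) u := by
  rw [seqProd_eq_prod, seqProd_eq_prod]
  refine Finset.prod_congr rfl fun i _ => ?_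
  rw [frozenProb, dif_pos i.isLt, frozenProb, dif_pos i.isLt]
  refine if_congr Iff.rfl (by simp) ?_
  rw [← condProb_shift D y w i.isLt]
  congr 1
  funext j
  simp [takePrefix, j.isLt.trans i.isLt]

theorem expectedDistortion_frozen {D : ℝ} (hD0 : 0 < D) (hD1 : D < 1) {n : ℕ}
    (F : Finset (Fin (2 ^ n))) (w : Fin (2 ^ n) → ZMod 2) :
    expectedDistortion D F w = expectedDistortion D F 0 := by
  rw [expectedDistortion_eq hD0 hD1, expectedDistortion_eq hD0 hD1]
  congr 1
  rw [← Equiv.sum_comp (Equiv.addRight (w ᵥ* polarMatrix n))]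
  refine Finset.sum_congr rfl fun y _ => ?_
  rw [← Equiv.sum_comp (Equiv.addRight w)]
  refine Finset.sum_congr rfl fun u _ => ?_
  simp only [Equiv.coe_addRight, distortion_shift]
  rw [seqProd_frozenProb_shift]

theorem sum_seqProd_frozenProb {n : ℕ} (F : Finset (Fin (2 ^ n))) (f : Fin (2 ^ n) → ZMod 2 → ℝ)
    (u : Fin (2 ^ n) → ZMod 2) :
    ∑ w : Fin (2 ^ n) → ZMod 2, seqProd (frozenProb F w f) (2 ^ n) u =
      2 ^ 2 ^ n * seqProd (uniformProb F f) (2 ^ n) u := by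
  let φ : Fin (2 ^ n) → ZMod 2 → ℝ := fun i b => if i ∈ F then if u i = b then 1 else 0 else
    condProb f i (fun j => u ⟨j, j.isLt.trans i.isLt⟩) (u i)
  have h : ∀ w : Fin (2 ^ n) → ZMod 2, seqProd (frozenProb F w f) (2 ^ n) u =
      ∏ i : Fin (2 ^ n), φ i (w i) := by
    intro w
    rw [seqProd_eq_prod]
    refine Finset.prod_congr rfl fun i _ => ?_
    rw [frozenProb, dif_pos i.isLt]
  rw [Finset.sum_congr rfl fun w _ => h w, sum_prod_eq φ, seqProd_eq_prod]
  have h2 : (2 : ℝ) ^ 2 ^ n = ∏ _i : Fin (2 ^ n), 2 := by simp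
  rw [h2, ← Finset.prod_mul_distrib]
  refine Finset.prod_congr rfl fun i _ => ?_
  rw [uniformProb, dif_pos i.isLt]
  simp only [Fin.eta, φ]
  split_ifs
  · rw [Finset.sum_ite_eq, if_pos (Finset.mem_univ _)]
    norm_num
  · rw [sum_bits, two_mul]

theorem expectedDistortion_eq_uniform {D : ℝ} (hD0 : 0 < D) (hD1 : D < 1) {n : ℕ}
    (F : Finset (Fin (2 ^ n))) :
    expectedDistortion D F 0 = (1 / 2) ^ 2 ^ n * ∑ y : Fin (2 ^ n) → ZMod 2, ∑ u,
      seqProd (uniformProb F fun j => bsc D (y j)) (2 ^ n) u * distortion y u := by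
  have h : (2 : ℝ) ^ 2 ^ n * expectedDistortion D F 0 =
      ∑ w : Fin (2 ^ n) → ZMod 2, expectedDistortion D F w := by
    rw [Finset.sum_congr rfl fun w _ => expectedDistortion_frozen hD0 hD1 F w]
    simp
  simp only [expectedDistortion_eq hD0 hD1 F] at h ⊢
  have h4 := Finset.sum_comm (s := Finset.univ) (t := Finset.univ)
    (f := fun (w : Fin (2 ^ n) → ZMod 2) (y : Fin (2 ^ n) → ZMod 2) => ∑ u,
      seqProd (frozenProb F w fun j => bsc D (y j)) (2 ^ n) u * distortion y u)
  rw [← Finset.mul_sum, h4] at h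
  have h3 : ∀ y : Fin (2 ^ n) → ZMod 2, ∑ w : Fin (2 ^ n) → ZMod 2, ∑ u,
      seqProd (frozenProb F w fun j => bsc D (y j)) (2 ^ n) u * distortion y u =
      2 ^ 2 ^ n * ∑ u, seqProd (uniformProb F fun j => bsc D (y j)) (2 ^ n) u *
        distortion y u := by
    intro y
    rw [Finset.sum_comm, Finset.mul_sum]
    refine Finset.sum_congr rfl fun u _ => ?_
    rw [← Finset.sum_mul, sum_seqProd_frozenProb, mul_assoc]
  rw [Finset.sum_congr rfl fun y _ => h3 y, ← Finset.mul_sum] at h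
  have hp : (2 : ℝ) ^ 2 ^ n ≠ 0 := by positivity
  refine mul_left_cancel₀ hp (h.trans ?_)
  ring

theorem sum_bsc (D : ℝ) (y : ZMod 2) : ∑ b, bsc D y b = 1 := by
  rw [sum_bits]
  rcases bit_cases y with rfl | rfl <;> simp [bsc]

/-- Through the binary symmetric channel, the expected distortion is the crossover probability. -/
theorem sum_prefixWeight_mul_distortion (D : ℝ) {n : ℕ} (y : Fin (2 ^ n) → ZMod 2) :
    ∑ u, prefixWeight (fun j => bsc D (y j)) (2 ^ n) u * distortion y u = D := by
  have hd : ∀ x : Fin (2 ^ n) → ZMod 2, (hammingDist y x : ℝ) = ∑ j, if y j = x j then 0 else 1 := by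
    intro x
    rw [hammingDist, Finset.card_filter]
    push_cast
    refine Finset.sum_congr rfl fun j _ => ?_
    split_ifs <;> simp_all
  have hj : ∀ j, ∑ x : Fin (2 ^ n) → ZMod 2, (∏ i, bsc D (y i) (x i)) *
      (if y j = x j then 0 else 1) = D := by
    intro j
    let φ : Fin (2 ^ n) → ZMod 2 → ℝ := fun i b =>
      bsc D (y i) b * if i = j then if y j = b then 0 else 1 else 1
    have h1 : ∀ x : Fin (2 ^ n) → ZMod 2, (∏ i, bsc D (y i) (x i)) *
        (if y j = x j then 0 else 1) = ∏ i, φ i (x i) := by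
      intro x
      rw [Finset.prod_mul_distrib]
      congr 1
      rw [Finset.prod_eq_single j]
      · rw [if_pos rfl]
      · exact fun i _ hi => if_neg hi
      · simp
    rw [Finset.sum_congr rfl fun x _ => h1 x, sum_prod_eq φ, Finset.prod_eq_single j]
    · rw [sum_bits]
      rcases bit_cases (y j) with h | h <;> simp [φ, h, bsc]
    · intro i _ hi
      simp only [φ, if_neg hi, mul_one, sum_bsc]
    · simp
  have h2 : ∑ u, prefixWeight (fun j => bsc D (y j)) (2 ^ n) u * distortion y u =
      ∑ x : Fin (2 ^ n) → ZMod 2, (∏ i, bsc D (y i) (x i)) * ((hammingDist y x : ℝ) / 2 ^ n) := by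
    refine Eq.trans ?_ (Equiv.sum_comp (transformEquiv n) fun x =>
      (∏ i, bsc D (y i) (x i)) * ((hammingDist y x : ℝ) / 2 ^ n))
    refine Finset.sum_congr rfl fun u _ => ?_
    rw [prefixWeight_full]
    rfl
  rw [h2]
  simp only [hd, ← mul_div_assoc, Finset.mul_sum]
  rw [← Finset.sum_div, Finset.sum_comm, Finset.sum_congr rfl fun j _ => hj j]
  simp

theorem expectedDistortion_le {D : ℝ} (hD0 : 0 < D) (hD1 : D < 1) {n : ℕ}
    (F : Finset (Fin (2 ^ n))) :
    expectedDistortion D F 0 ≤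
      D + ∑ i ∈ F, (BitSource.synth n i (bscSource D hD0 hD1)).bias := by
  have hf : ∀ (y : Fin (2 ^ n) → ZMod 2) (i) (b), 0 < bsc D (y i) b :=
    fun y i b => bsc_pos hD0 hD1 _ _
  -- the distance between the laws with uniform and with optimal frozen bits
  have htv : ∀ y : Fin (2 ^ n) → ZMod 2,
      ∑ u, |seqProd (condProb fun j => bsc D (y j)) (2 ^ n) u -
        seqProd (uniformProb F fun j => bsc D (y j)) (2 ^ n) u| ≤
      ∑ i ∈ F, ∑ p : Fin (i : ℕ) → ZMod 2,
        |prefixWeight (fun j => bsc D (y j)) (i + 1) (Fin.snoc p 0) -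
          prefixWeight (fun j => bsc D (y j)) (i + 1) (Fin.snoc p 1)| := by
    intro y
    refine (sum_abs_seqProd_sub_le _ _ _ fun k hk p => ?_).trans ?_
    · rw [← sum_condProb (hf y) hk p]
      simp only [uniformProb, dif_pos hk]
      split_ifs
      · rw [sum_condProb (hf y) hk p, sum_bits, abs_of_pos (by norm_num)]
        norm_num
      · refine (Finset.sum_congr rfl fun b _ => abs_of_nonneg ?_).le
        exact div_nonneg (prefixWeight_pos (hf y) _ _).le (prefixWeight_pos (hf y) _ _).le
    · rw [Finset.sum_range, ← Finset.sum_subset (Finset.subset_univ F)]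
      · refine Finset.sum_le_sum fun i hi => Finset.sum_le_sum fun p _ => ?_
        have hs := prefixWeight_snoc_add (fun j => bsc D (y j)) i.isLt p
        rw [sum_bits] at hs
        have hp := prefixWeight_pos (hf y) i p
        have e : ∀ b, |prefixWeight (fun j => bsc D (y j)) i p| *
            |condProb (fun j => bsc D (y j)) i p b - 1 / 2| =
            |prefixWeight (fun j => bsc D (y j)) (i + 1) (Fin.snoc p b) -
              prefixWeight (fun j => bsc D (y j)) i p / 2| := by
          intro b
          rw [← abs_mul, condProb, mul_sub, mul_div_cancel₀ _ hp.ne', mul_one_div]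
        rw [seqProd_condProb (hf y) (fun i => sum_bsc D _), Finset.mul_sum]
        simp only [uniformProb, dif_pos i.isLt, Fin.eta, if_pos hi]
        rw [Finset.sum_congr rfl fun b _ => e b, sum_bits, ← hs]
        refine le_of_eq ?_
        generalize prefixWeight (fun j => bsc D (y j)) (i + 1) (Fin.snoc p 0) = a
        generalize prefixWeight (fun j => bsc D (y j)) (i + 1) (Fin.snoc p 1) = b
        have e1 : a - (a + b) / 2 = (a - b) / 2 := by ring
        have e2 : b - (a + b) / 2 = -((a - b) / 2) := by ring
        rw [e1, e2, abs_neg, abs_div, abs_two]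
        ring
      · intro i _ hi
        refine Finset.sum_eq_zero fun p _ => ?_
        simp only [uniformProb, dif_pos i.isLt, Fin.eta, if_neg hi, sub_self, abs_zero,
          Finset.sum_const_zero, mul_zero]
  have hy : ∀ y : Fin (2 ^ n) → ZMod 2,
      ∑ u, seqProd (uniformProb F fun j => bsc D (y j)) (2 ^ n) u * distortion y u ≤
      D + ∑ i ∈ F, ∑ p : Fin (i : ℕ) → ZMod 2,
        |prefixWeight (fun j => bsc D (y j)) (i + 1) (Fin.snoc p 0) -
          prefixWeight (fun j => bsc D (y j)) (i + 1) (Fin.snoc p 1)| := by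
    intro y
    refine le_trans ?_ (add_le_add_right (htv y) D)
    refine le_trans ?_ (add_le_add_left (sum_prefixWeight_mul_distortion D y).le _)
    rw [← Finset.sum_add_distrib]
    refine Finset.sum_le_sum fun u _ => ?_
    rw [← seqProd_condProb (hf y) (fun i => sum_bsc D _)]
    have h0 := distortion_nonneg y u
    have h1 := distortion_le_one y u
    have h2 := neg_abs_le (seqProd (condProb fun j => bsc D (y j)) (2 ^ n) u -
        seqProd (uniformProb F fun j => bsc D (y j)) (2 ^ n) u)
    have h3 := abs_nonneg (seqProd (condProb fun j => bsc D (y j)) (2 ^ n) u -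
        seqProd (uniformProb F fun j => bsc D (y j)) (2 ^ n) u)
    nlinarith
  rw [expectedDistortion_eq_uniform hD0 hD1]
  refine (mul_le_mul_of_nonneg_left (Finset.sum_le_sum fun y _ => hy y)
    (by positivity)).trans_eq ?_
  rw [Finset.sum_add_distrib, mul_add]
  congr 1
  · simp
  · rw [Finset.sum_comm, Finset.mul_sum]
    exact Finset.sum_congr rfl fun i _ => (bias_synth_bscSource hD0 hD1 i).symm

end PolarSource

namespace PolarSource

open Filter BitSource

/-! ## The codes -/

open Classical in
/-- The polar code whose frozen indices have Bhattacharyya parameter at least `t`. -/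
noncomputable def thresholdCode (D : ℝ) (n : ℕ) (t : ℝ) : PolarCode D n where
  frozen := Finset.univ.filter fun i => t ≤ bhattacharyya D i
  threshold := ⟨t, fun i => by simp⟩

theorem mem_thresholdCode {D : ℝ} {n : ℕ} {t : ℝ} {i : Fin (2 ^ n)} :
    i ∈ (thresholdCode D n t).frozen ↔ t ≤ bhattacharyya D i := by
  simp [thresholdCode]

theorem rate_thresholdCode_zero (D : ℝ) (n : ℕ) : (thresholdCode D n 0).rate = 0 := by
  have : (thresholdCode D n 0).frozen = Finset.univ := Finset.eq_univ_of_forall fun i =>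
    mem_thresholdCode.2 (Finset.sum_nonneg fun _ _ => Finset.sum_nonneg fun _ _ =>
      Real.sqrt_nonneg _)
  rw [PolarCode.rate, this, Finset.card_univ, Fintype.card_fin]
  push_cast
  rw [div_self (by positivity), sub_self]

theorem rate_thresholdCode_le {D : ℝ} (hD0 : 0 < D) (hD1 : D < 1) (n : ℕ) (δ : ℝ) :
    (thresholdCode D n (1 - δ)).rate ≤ avg (biased δ) n (bscSource D hD0 hD1) := by
  have h : (2 : ℝ) ^ n - ((thresholdCode D n (1 - δ)).frozen.card : ℝ) ≤
      2 ^ n * avg (biased δ) n (bscSource D hD0 hD1) := by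
    have hc : (2 : ℝ) ^ n - ((thresholdCode D n (1 - δ)).frozen.card : ℝ) =
        ∑ i, if i ∈ (thresholdCode D n (1 - δ)).frozen then (0 : ℝ) else 1 := by
      have hi : ∀ i : Fin (2 ^ n), (if i ∈ (thresholdCode D n (1 - δ)).frozen then (0 : ℝ) else 1) =
          1 - if i ∈ (thresholdCode D n (1 - δ)).frozen then 1 else 0 := fun i => by
        split_ifs <;> norm_num
      rw [Finset.sum_congr rfl fun i _ => hi i, Finset.sum_sub_distrib]
      simp
    rw [hc, ← sum_synth]
    refine Finset.sum_le_sum fun i _ => ?_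
    split_ifs with hi
    · exact biased_nonneg _ _
    · rw [mem_thresholdCode, not_le, bhattacharyya_eq hD0 hD1] at hi
      rw [biased, if_pos]
      linarith [(synth n i (bscSource D hD0 hD1)).one_sub_bias_le_bhat]
  have hN : (0 : ℝ) < 2 ^ n := by positivity
  rw [PolarCode.rate, one_sub_div hN.ne', div_le_iff₀ hN]
  linarith

theorem expectedDistortion_thresholdCode_le {D : ℝ} (hD0 : 0 < D) (hD1 : D < 1) (n : ℕ) {δ η : ℝ}
    (hη : 0 ≤ η) (h : 2 * δ ≤ η ^ 2) :
    expectedDistortion D (thresholdCode D n (1 - δ)).frozen 0 ≤ D + 2 ^ n * η := by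
  refine (expectedDistortion_le hD0 hD1 _).trans (add_le_add_right ?_ D)
  have hb : ∀ i ∈ (thresholdCode D n (1 - δ)).frozen,
      (synth n i (bscSource D hD0 hD1)).bias ≤ η := by
    intro i hi
    rw [mem_thresholdCode, bhattacharyya_eq hD0 hD1] at hi
    refine le_of_sq_le_sq ?_ hη
    linarith [(synth n i (bscSource D hD0 hD1)).bias_sq_le]
  refine (Finset.sum_le_card_nsmul _ _ η hb).trans ?_
  rw [nsmul_eq_mul]
  refine mul_le_mul_of_nonneg_right ?_ hη
  have := Finset.card_le_univ (thresholdCode D n (1 - δ)).frozen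
  rw [Fintype.card_fin] at this
  exact_mod_cast this

/-- The exponent of the threshold. -/
noncomputable def exponent (β : ℝ) (n : ℕ) : ℝ := 2 * (2 : ℝ) ^ (β * n) + 2 * n + 1

theorem exponent_pos (β : ℝ) (n : ℕ) : 0 < exponent β n := by unfold exponent; positivity

theorem exponent_le {β : ℝ} (hβ : 0 < β) (n : ℕ) :
    exponent β n ≤ (3 + 2 / (β * Real.log 2)) * (2 : ℝ) ^ (β * n) := by
  have hlog : 0 < Real.log 2 := Real.log_pos one_lt_two
  have h1 : 1 ≤ (2 : ℝ) ^ (β * n) := Real.one_le_rpow one_le_two (by positivity)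
  have h2 : β * Real.log 2 * n ≤ (2 : ℝ) ^ (β * n) := by
    rw [Real.rpow_def_of_pos two_pos]
    have := Real.add_one_le_exp (Real.log 2 * (β * n))
    linarith
  have h3 : (n : ℝ) ≤ (2 : ℝ) ^ (β * n) / (β * Real.log 2) := by
    rw [le_div_iff₀ (by positivity)]
    linarith
  have h4 : 2 / (β * Real.log 2) * (2 : ℝ) ^ (β * n) =
      2 * ((2 : ℝ) ^ (β * n) / (β * Real.log 2)) := by ring
  unfold exponent
  linarith

theorem two_mul_exponent (β : ℝ) (n : ℕ) :
    2 * (2 : ℝ) ^ (-exponent β n) = ((2 : ℝ) ^ (-(2 : ℝ) ^ (β * n) - n)) ^ 2 := by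
  have h : 2 * (2 : ℝ) ^ (-exponent β n) = (2 : ℝ) ^ (1 : ℝ) * (2 : ℝ) ^ (-exponent β n) := by
    rw [Real.rpow_one]
  rw [h, ← Real.rpow_mul_natCast two_pos.le, ← Real.rpow_add two_pos]
  congr 1
  unfold exponent
  push_cast
  ring

theorem two_pow_mul_rpow (β : ℝ) (n : ℕ) :
    (2 : ℝ) ^ n * (2 : ℝ) ^ (-(2 : ℝ) ^ (β * n) - n) = (2 : ℝ) ^ (-((2 : ℝ) ^ n) ^ β) := by
  rw [← Real.rpow_natCast, ← Real.rpow_add two_pos, ← Real.rpow_mul two_pos.le]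
  congr 1
  rw [mul_comm β]
  ring

end PolarSource

theorem theorem1 (D R β : ℝ) (hD0 : 0 < D) (hD1 : D < 1 / 2) (hR : 1 - PolarSource.h₂ D < R)
    (hβ0 : 0 < β) (hβ1 : β < 1 / 2) :
    ∃ code : (n : ℕ) → PolarSource.PolarCode D n,
      -- the rates are below `R`
      (∀ n, (code n).rate < R) ∧
      -- expected distortion under successive-cancellation encoding with randomized rounding
      (∃ C : ℝ, ∀ n,
        PolarSource.expectedDistortion D (code n).frozen 0
          ≤ D + C * (2 : ℝ) ^ (-(((2 : ℝ) ^ n) ^ β))) ∧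
      -- the algorithms implement the encoding and the decoding function
      (∀ n, ∀ y : Fin (2 ^ n) → ZMod 2,
        (PolarSource.encoderProg D (code n).frozen 0 y).run
          = PolarSource.scEncoder D (code n).frozen 0 y) ∧
      (∀ n, ∀ v : {i // i ∉ (code n).frozen} → ZMod 2,
        (PolarSource.decoderProg (code n).frozen 0 v).run
          = PMF.pure (PolarSource.decoder (code n).frozen 0 v)) ∧
      -- and both run in time `Θ(N log N)` with `N = 2 ^ n`
      (fun n => (PolarSource.encodingTime D (code n).frozen 0 : ℝ))
        =Θ[Filter.atTop] (fun n => (2 : ℝ) ^ n * Real.log ((2 : ℝ) ^ n)) ∧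
      (fun n => (PolarSource.decodingTime (code n).frozen 0 : ℝ))
        =Θ[Filter.atTop] (fun n => (2 : ℝ) ^ n * Real.log ((2 : ℝ) ^ n)) := by
  open PolarSource in
  have hD1' : D < 1 := by linarith
  have hlog : 0 < Real.log 2 := Real.log_pos one_lt_two
  have hR0 : 0 < R := by
    have : h₂ D ≤ 1 := (div_le_one hlog).2 Real.binEntropy_le_log_two
    linarith
  obtain ⟨n₀, hn₀⟩ := Filter.eventually_atTop.1 <|
    (bscSource D hD0 hD1').eventually_avg_biased_le hβ0 hβ1
      (ε := (R - (1 - h₂ D)) / 2) (by linarith) (exponent_pos β) (exponent_le hβ0)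
  rw [entropy_bscSource] at hn₀
  let code : (n : ℕ) → PolarCode D n := fun n =>
    thresholdCode D n (if n₀ ≤ n then 1 - (2 : ℝ) ^ (-exponent β n) else 0)
  refine ⟨code, fun n => ?_, ?_, fun n y => run_encoderProg hD0 hD1' _ _ _,
    fun n v => run_decoderProg _ _ _, encodingTime_isTheta D _, decodingTime_isTheta _⟩
  · by_cases hn : n₀ ≤ n
    · simp only [code, if_pos hn]
      have h1 := rate_thresholdCode_le hD0 hD1' n ((2 : ℝ) ^ (-exponent β n))
      have h2 := hn₀ n hn
      rw [← h₂] at h2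
      linarith
    · simp only [code, if_neg hn, rate_thresholdCode_zero]
      exact hR0
  · have hx : ∀ n : ℕ, 0 < (2 : ℝ) ^ (-(((2 : ℝ) ^ n) ^ β)) := fun n => by positivity
    have hterm : ∀ n : ℕ, 0 ≤ |expectedDistortion D (code n).frozen 0| /
        (2 : ℝ) ^ (-(((2 : ℝ) ^ n) ^ β)) := fun n => div_nonneg (abs_nonneg _) (hx n).le
    refine ⟨1 + ∑ n ∈ Finset.range n₀, |expectedDistortion D (code n).frozen 0| /
      (2 : ℝ) ^ (-(((2 : ℝ) ^ n) ^ β)), fun n => ?_⟩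
    have hsum := Finset.sum_nonneg fun n (_ : n ∈ Finset.range n₀) => hterm n
    by_cases hn : n₀ ≤ n
    · have h1 := expectedDistortion_thresholdCode_le hD0 hD1' n (by positivity)
        (two_mul_exponent β n).le
      rw [two_pow_mul_rpow] at h1
      have h2 : expectedDistortion D (code n).frozen 0 ≤ D + (2 : ℝ) ^ (-(((2 : ℝ) ^ n) ^ β)) := by
        simpa only [code, if_pos hn] using h1
      nlinarith [mul_nonneg hsum (hx n).le]
    · have h1 := Finset.single_le_sum (fun n _ => hterm n)
        (Finset.mem_range.2 (not_le.1 hn))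
      rw [div_le_iff₀ (hx n)] at h1
      have h2 := le_abs_self (expectedDistortion D (code n).frozen 0)
      linarith [hx n]
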